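/- Let $d_1,d_2\ge 1$ and $D=d_1+d_2$, and write $\mathbb{R}^D=\mathbb{R}^{d_1}\times\mathbb{R}^{d_2}$. Let $$\mathcal{B}_1=\{\mathcal{M}\subset\mathbb{R}^D \text{ compact} : \exists x_1\in\mathbb{R}^{d_1},\ \mathrm{Card}\big((\{x_1\}\times\mathbb{R}^{d_2})\cap \mathcal{M}\big)=1\},$$ $$\mathcal{B}_2=\{\mathcal{M}\subset\mathbb{R}^D \text{ compact} : \exists x_2\in\mathbb{R}^{d_2},\ \mathrm{Card}\big((\mathbb{R}^{d_1}\times\{x_2\})\cap \mathcal{M}\big)=1\}.$$ A simplicial tiling of $A\subset\mathbb{R}^D$ is a simplicial complex in which every simplex is a face of a $D$-simplex and whose simplices have relative interiors that form a partition of $A$. Let $\mathcal{P}_0$ be a finite simplicial tiling of $[0,1]^D$, and let $\mathcal{P}$ be its extension to $\mathbb{R}^D$ by mirroring: for each $k\in\mathbb{Z}^D$, the cube $\prod_i[k_i,k_i+1]$ carries the translate of $\mathcal{P}_0$ by $k$, mirrored along axis $i$ if and only if $k_i$ is odd. Then $\mathcal{P}$ is a simplicial tiling of $\mathbb{R}^D$,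 and its vertices can be enumerated without repetition as a sequence $(x_n)_{n\in\mathbb{N}}$. Fix such an enumeration. For $\varepsilon=(\varepsilon_n)_{n\in\mathbb{N}}$ in $(\mathbb{R}^D)^{\mathbb{N}}$, let $\mathcal{P}^\varepsilon$ consist of the simplices with vertices $\{x_i+\varepsilon_i\}_{i\in I}$, where $\{x_i\}_{i\in I}$ runs over the vertex sets of the simplices of $\mathcal{P}$, and let $f^\varepsilon:\mathbb{R}^D\to\mathbb{R}^D$ send $z=\sum_{i\in I}\alpha_i x_i$ (where $\{x_i\}_{i\in I}$ is the unique simplex of $\mathcal{P}$ whose relative interior contains $z$, and $\alpha_i>0$, $\sum_{i\in I}\alpha_i=1$) to $\sum_{i\in I}\alpha_i(x_i+\varepsilon_i)$. Call $r_0>0$ admissible if for every $\varepsilon\in([-r_0,r_0]^D)^{\mathbb{N}}$ the family $\mathcal{P}^\varepsilon$ is a simplicial tiling of $\mathbb{R}^D$ and $f^\varepsilon$ is a homeomorphism of $\mathbb{R}^D$. Theorem. An admissible $r_0$ exists. Moreover, let $r_0$ be admissible, $r\in(0,r_0]$, $\delta>0$, let $\varepsilon=(\varepsilon_n)_{n\in\mathbb{N}}$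 be a sequence of i.i.d. random variables, uniform on $[-r,r]^D$, and let $G:\mathbb{R}^D\to\mathbb{R}^D$ be any random continuous mapping that is independent of $\varepsilon$. Put $F(z)=\delta f^\varepsilon(G(z)/\delta)$. Then for every non-empty compact set $\mathcal{M}\subset\mathbb{R}^D$, almost surely $F(\mathcal{M})\in\mathcal{B}_1\cap\mathcal{B}_2$. -/

import Mathlib

open MeasureTheory ProbabilityTheory

/-- A set `F` of simplices of `ℝ^D`, each given by its finite set of vertices, is a *simplicial
tiling* of `A`: it is the set of faces of a (geometric) simplicial complex, every simplex is a face
of a `D`-simplex of `F`, and the simplices cover exactly `A`. In a simplicial complex, every point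
of the covered region lies in the relative interior of exactly one simplex, so that the last
condition says that the relative interiors of the simplices form a partition of `A`. -/
def IsSimplicialTiling {D : ℕ} (F : Set (Finset (Fin D → ℝ))) (A : Set (Fin D → ℝ)) : Prop :=
  ∃ K : Geometry.SimplicialComplex ℝ (Fin D → ℝ),
    K.faces = F ∧ (∀ s ∈ F, ∃ t ∈ F, s ⊆ t ∧ t.card = D + 1) ∧ K.space = A

/-- The map from the unit cube `[0,1]^D` onto the cube `∏ i, [k i, k i + 1]` which translates by
`k` and is mirrored along the axis `i` if and only if `k i` is odd. -/
noncomputable def mirrorMap {D : ℕ} (k : Fin D → ℤ) (z : Fin D → ℝ) : Fin D → ℝ :=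
  fun i => if Even (k i) then (k i : ℝ) + z i else (k i : ℝ) + (1 - z i)

/-- The extension to `ℝ^D` of a family of simplices of `[0,1]^D`, by mirroring it along the
hyperplanes orthogonal to the axes at integer coordinates. -/
def mirrorFaces {D : ℕ} (F₀ : Set (Finset (Fin D → ℝ))) : Set (Finset (Fin D → ℝ)) :=
  {t | ∃ k : Fin D → ℤ, ∃ s ∈ F₀, (t : Set (Fin D → ℝ)) = mirrorMap k '' (s : Set (Fin D → ℝ))}

/-- The sequence `x` enumerates, without repetition, the vertices (`0`-simplices) of `F`. -/
def EnumeratesVertices {D : ℕ} (x : ℕ → Fin D → ℝ) (F : Set (Finset (Fin D → ℝ))) : Prop :=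
  Function.Injective x ∧ Set.range x = {v | {v} ∈ F}

/-- The family of simplices `{x i + ε i}_{i ∈ I}`, for `{x i}_{i ∈ I}` in `F`. -/
def perturbedFaces {D : ℕ} (x : ℕ → Fin D → ℝ) (F : Set (Finset (Fin D → ℝ)))
    (ε : ℕ → Fin D → ℝ) : Set (Finset (Fin D → ℝ)) :=
  {t | ∃ I : Finset ℕ, (∃ s ∈ F, (s : Set (Fin D → ℝ)) = x '' (I : Set ℕ)) ∧
    (t : Set (Fin D → ℝ)) = (fun i => x i + ε i) '' (I : Set ℕ)}

/-- `z = ∑ i ∈ I, α i • x i` with positive weights of sum `1`, where `I` is the support of `α` and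
`{x i}_{i ∈ I}` is a simplex of `F`; that is, `z` lies in the relative interior of this simplex and
has barycentric coordinates `α`. -/
def IsBarycentric {D : ℕ} (x : ℕ → Fin D → ℝ) (F : Set (Finset (Fin D → ℝ)))
    (z : Fin D → ℝ) (α : ℕ →₀ ℝ) : Prop :=
  (∃ s ∈ F, (s : Set (Fin D → ℝ)) = x '' (α.support : Set ℕ)) ∧
    (∀ i ∈ α.support, 0 < α i) ∧ ∑ i ∈ α.support, α i = 1 ∧ ∑ i ∈ α.support, α i • x i = z

open Classical in
/-- The perturbation `f^ε`: it sends `z = ∑ i ∈ I, α i • x i`, in the relative interior of the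
simplex `{x i}_{i ∈ I}` of `F`, to `∑ i ∈ I, α i • (x i + ε i)`. When `F` is a tiling of `ℝ^D` with
vertices `x`, the weights `α` exist and are unique for all `z`. -/
noncomputable def perturbationMap {D : ℕ} (x : ℕ → Fin D → ℝ) (F : Set (Finset (Fin D → ℝ)))
    (ε : ℕ → Fin D → ℝ) (z : Fin D → ℝ) : Fin D → ℝ :=
  if h : ∃ α, IsBarycentric x F z α then
    ∑ i ∈ h.choose.support, h.choose i • (x i + ε i)
  else z

/-- The cube `[-r, r]^D`. -/
def centeredCube (D : ℕ) (r : ℝ) : Set (Fin D → ℝ) :=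
  Set.Icc (fun _ => -r) (fun _ => r)

/-- `r₀ > 0` is so small that moving every vertex of `F` by any vector of `[-r₀, r₀]^D` leaves a
simplicial tiling of `ℝ^D` and gives a homeomorphism `f^ε` of `ℝ^D`. -/
def IsAdmissibleRadius {D : ℕ} (x : ℕ → Fin D → ℝ) (F : Set (Finset (Fin D → ℝ)))
    (r₀ : ℝ) : Prop :=
  0 < r₀ ∧ ∀ ε : ℕ → Fin D → ℝ, (∀ n, ε n ∈ centeredCube D r₀) →
    IsSimplicialTiling (perturbedFaces x F ε) Set.univ ∧ IsHomeomorph (perturbationMap x F ε)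

/-- Compact sets `M ⊆ ℝ^(d₁ + d₂)` such that `({x₁} × ℝ^d₂) ∩ M` has exactly one point, for some
`x₁ ∈ ℝ^d₁`. -/
def setB₁ (d₁ d₂ : ℕ) : Set (Set (Fin (d₁ + d₂) → ℝ)) :=
  {M | IsCompact M ∧ ∃ x₁ : Fin d₁ → ℝ,
    ({z | ∀ i : Fin d₁, z (Fin.castAdd d₂ i) = x₁ i} ∩ M).ncard = 1}

/-- Compact sets `M ⊆ ℝ^(d₁ + d₂)` such that `(ℝ^d₁ × {x₂}) ∩ M` has exactly one point, for some
`x₂ ∈ ℝ^d₂`. -/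
def setB₂ (d₁ d₂ : ℕ) : Set (Set (Fin (d₁ + d₂) → ℝ)) :=
  {M | IsCompact M ∧ ∃ x₂ : Fin d₂ → ℝ,
    ({z | ∀ i : Fin d₂, z (Fin.natAdd d₁ i) = x₂ i} ∩ M).ncard = 1}

/-! Barycentric coordinates make everything linear in the noise: coordinate `c` of `f^ε(y)` is `∑ i,
β i y * (x i c + ε i c)`, where the `β i` are continuous, locally finite and independent of `ε`. For
`Y = G/δ` on a compact `M`, let `S(ε)` be the maximum of this coordinate over `Y(M)`. As a function
of the single vector `ε i` it is a supremum of 1-Lipschitz affine functions, hence differentiable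
almost everywhere by Rademacher. Each maximizer `z` contributes a slope `β i (Y z)` touching `S`
from below, so where `S` is differentiable all maximizers have the same `β i`. Independence and
Fubini give this almost surely for all `i` at once (`ae_unique_argmax`). Barycentric coordinates
determine the point, so `Y`, and hence `F`, is constant on the maximizers: the hyperplane where
coordinate `c` of `F(M)` is maximal meets `F(M)` in one point. A coordinate `c` from the first block
yields `setB₁`, one from the second yields `setB₂`.

To stay measurable, suprema run over a dense sequence of `M`, and differentiability is replaced by
its consequence that `supFormDiff` tends to `0`.

For the admissible radius, `f^ε` is the identity plus a map whose Lipschitz constant is at most `ρ *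
L`, where `ρ` bounds the noise and `L` bounds the barycentric coordinates on all simplices
(`norm_bary_sum_sub_le`). Such an `L` exists because mirroring is isometric and the initial tiling
is finite. If `ρ * L ≤ 1 / 2`, then `f^ε` is a homeomorphism, and it carries the tiling to the
perturbed one. -/

open Filter Topology

/-! ### Barycentric coordinates of a tiling and the perturbation map. -/

section Barycentric

variable {D : ℕ} {x : ℕ → Fin D → ℝ} {F : Set (Finset (Fin D → ℝ))}

theorem exists_weights_of_mem_convexHull_image (hx : Function.Injective x) {I : Finset ℕ}
    {z : Fin D → ℝ} (hz : z ∈ convexHull ℝ (x '' (I : Set ℕ))) :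
    ∃ w : ℕ →₀ ℝ, w.support ⊆ I ∧ (∀ i, 0 ≤ w i) ∧ ∑ i ∈ I, w i = 1 ∧
      ∑ i ∈ I, w i • x i = z := by
  classical
  rw [← Finset.coe_image, Finset.mem_convexHull'] at hz
  obtain ⟨v, hv0, hv1, hvz⟩ := hz
  rw [Finset.sum_image hx.injOn] at hv1 hvz
  refine ⟨Finsupp.onFinset I (fun i => if i ∈ I then v (x i) else 0) ?_, ?_, ?_, ?_, ?_⟩
  · intro i hi
    by_contra h
    simp [h] at hi
  · exact Finsupp.support_onFinset_subset
  · intro i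
    simp only [Finsupp.onFinset_apply]
    split_ifs with h
    · exact hv0 _ (Finset.mem_image_of_mem x h)
    · exact le_rfl
  · rw [← hv1]
    exact Finset.sum_congr rfl fun _ hi => by simp [hi]
  · rw [← hvz]
    exact Finset.sum_congr rfl fun _ hi => by simp [hi]

theorem sum_smul_mem_convexHull_image {y : ℕ → Fin D → ℝ} {I : Finset ℕ} {w : ℕ → ℝ}
    (h0 : ∀ i ∈ I, 0 ≤ w i) (h1 : ∑ i ∈ I, w i = 1) :
    ∑ i ∈ I, w i • y i ∈ convexHull ℝ (y '' (I : Set ℕ)) :=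
  (convex_convexHull ℝ _).sum_mem h0 h1 fun _ hi =>
    subset_convexHull ℝ _ (Set.mem_image_of_mem y hi)

theorem sum_subset_support {V : Type*} [AddCommMonoid V] [Module ℝ V] {w : ℕ →₀ ℝ} {I : Finset ℕ}
    (h : w.support ⊆ I) (y : ℕ → V) : ∑ i ∈ w.support, w i • y i = ∑ i ∈ I, w i • y i :=
  Finset.sum_subset h fun i _ hi => by simp [Finsupp.notMem_support_iff.1 hi]

theorem sum_support_weights {w : ℕ →₀ ℝ} {I : Finset ℕ}
    (h : w.support ⊆ I) : ∑ i ∈ w.support, w i = ∑ i ∈ I, w i :=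
  Finset.sum_subset h fun _ _ hi => Finsupp.notMem_support_iff.1 hi

/-- The simplices of `F` as sets of indices of their vertices. -/
def indexFaces (x : ℕ → Fin D → ℝ) (F : Set (Finset (Fin D → ℝ))) : Set (Finset ℕ) :=
  {I | ∃ s ∈ F, (s : Set (Fin D → ℝ)) = x '' (I : Set ℕ)}

namespace IsSimplicialTiling

theorem down_closed {A : Set (Fin D → ℝ)} (hF : IsSimplicialTiling F A)
    {s t : Finset (Fin D → ℝ)} (hs : s ∈ F) (hts : t ⊆ s) (ht : t.Nonempty) : t ∈ F := by
  obtain ⟨K, rfl, -⟩ := hF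
  exact K.down_closed hs hts ht

theorem nonempty {A : Set (Fin D → ℝ)} (hF : IsSimplicialTiling F A)
    {s : Finset (Fin D → ℝ)} (hs : s ∈ F) : s.Nonempty := by
  obtain ⟨K, rfl, -⟩ := hF
  exact K.nonempty_of_mem_faces hs

theorem indep {A : Set (Fin D → ℝ)} (hF : IsSimplicialTiling F A)
    {s : Finset (Fin D → ℝ)} (hs : s ∈ F) :
    AffineIndependent ℝ ((↑) : s → Fin D → ℝ) := by
  obtain ⟨K, rfl, -⟩ := hF
  exact K.indep hs

theorem inter_subset {A : Set (Fin D → ℝ)} (hF : IsSimplicialTiling F A)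
    {s t : Finset (Fin D → ℝ)} (hs : s ∈ F) (ht : t ∈ F) :
    convexHull ℝ (s : Set (Fin D → ℝ)) ∩ convexHull ℝ (t : Set (Fin D → ℝ)) ⊆
      convexHull ℝ ((s : Set (Fin D → ℝ)) ∩ t) := by
  obtain ⟨K, rfl, -⟩ := hF
  exact K.inter_subset_convexHull hs ht

theorem mem_iff {A : Set (Fin D → ℝ)} (hF : IsSimplicialTiling F A) {z : Fin D → ℝ} :
    z ∈ A ↔ ∃ s ∈ F, z ∈ convexHull ℝ (s : Set (Fin D → ℝ)) := by
  obtain ⟨K, rfl, -, rfl⟩ := hF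
  exact K.mem_space_iff

theorem exists_index {A : Set (Fin D → ℝ)} (hF : IsSimplicialTiling F A)
    (hx : EnumeratesVertices x F) {s : Finset (Fin D → ℝ)} (hs : s ∈ F) :
    ∃ I : Finset ℕ, (s : Set (Fin D → ℝ)) = x '' (I : Set ℕ) := by
  refine ⟨s.preimage x hx.1.injOn, ?_⟩
  rw [Finset.coe_preimage, Set.image_preimage_eq_iff.2]
  intro v hv
  rw [hx.2]
  exact hF.down_closed hs (Finset.singleton_subset_iff.2 hv) (Finset.singleton_nonempty v)

theorem eq_zero_of_sum_eq_zero {A : Set (Fin D → ℝ)} (hF : IsSimplicialTiling F A)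
    (hx : Function.Injective x) {I : Finset ℕ} (hI : I ∈ indexFaces x F) {u : ℕ → ℝ}
    (h0 : ∑ i ∈ I, u i = 0) (h1 : ∑ i ∈ I, u i • x i = 0) : ∀ i ∈ I, u i = 0 := by
  classical
  obtain ⟨s, hs, hsI⟩ := hI
  have hsI' : s = I.image x := by
    apply Finset.coe_injective
    rw [hsI, Finset.coe_image]
  -- The left inverse of `x` turns weights on indices into weights on vertices.
  have key := (hF.indep hs).eq_zero_of_sum_eq_zero_subtype (w := u ∘ Function.invFun x) (s := s)
  have hinv : ∀ i, Function.invFun x (x i) = i := Function.leftInverse_invFun hx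
  intro i hi
  have := key ?_ ?_ (x i) (by rw [hsI']; exact Finset.mem_image_of_mem x hi)
  · simpa [hinv] using this
  · rw [hsI', Finset.sum_image hx.injOn]
    simpa [hinv] using h0
  · rw [hsI', Finset.sum_image hx.injOn]
    simpa [hinv] using h1

theorem mem_indexFaces_of_subset {A : Set (Fin D → ℝ)} (hF : IsSimplicialTiling F A)
    {I J : Finset ℕ} (hI : I ∈ indexFaces x F) (hJI : J ⊆ I) (hJ : J.Nonempty) :
    J ∈ indexFaces x F := by
  classical
  obtain ⟨s, hs, hsI⟩ := hI
  refine ⟨J.image x, hF.down_closed hs ?_ (hJ.image x), Finset.coe_image⟩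
  rw [← Finset.coe_subset, hsI, Finset.coe_image]
  exact Set.image_mono (by exact_mod_cast hJI)

theorem isBarycentric_of_support_subset {A : Set (Fin D → ℝ)} (hF : IsSimplicialTiling F A)
    {I : Finset ℕ} (hI : I ∈ indexFaces x F) {w : ℕ →₀ ℝ} (hw : w.support ⊆ I)
    (h0 : ∀ i, 0 ≤ w i) (h1 : ∑ i ∈ I, w i = 1) :
    IsBarycentric x F (∑ i ∈ I, w i • x i) w := by
  refine ⟨hF.mem_indexFaces_of_subset hI hw ?_, fun i hi => ?_, ?_, ?_⟩
  · rw [Finset.nonempty_iff_ne_empty, Ne, Finsupp.support_eq_empty]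
    rintro rfl
    simp at h1
  · exact lt_of_le_of_ne (h0 i) (Finsupp.mem_support_iff.1 hi).symm
  · rw [sum_support_weights hw, h1]
  · rw [sum_subset_support hw]

/-- The simplices carrying `v` and `w` meet in the hull of their common vertices, so `z` also has
weights `g` on those. Affine independence within each simplex forces both `v` and `w` to equal `g`.
-/
theorem isBarycentric_unique {A : Set (Fin D → ℝ)} (hF : IsSimplicialTiling F A)
    (hx : Function.Injective x) {z : Fin D → ℝ} {v w : ℕ →₀ ℝ}
    (hv : IsBarycentric x F z v) (hw : IsBarycentric x F z w) : v = w := by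
  classical
  have key : ∀ {v w : ℕ →₀ ℝ}, IsBarycentric x F z v → IsBarycentric x F z w →
      z ∈ convexHull ℝ (x '' ((v.support ∩ w.support : Finset ℕ) : Set ℕ)) := by
    rintro v w ⟨⟨s, hs, hsv⟩, hv0, hv1, hvz⟩ ⟨⟨t, ht, htw⟩, hw0, hw1, hwz⟩
    have := hF.inter_subset hs ht ⟨?_, ?_⟩ (a := z)
    · rwa [hsv, htw, ← Set.image_inter hx, ← Finset.coe_inter] at this
    · rw [hsv, ← hvz]
      exact sum_smul_mem_convexHull_image (fun i hi => (hv0 i hi).le) hv1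
    · rw [htw, ← hwz]
      exact sum_smul_mem_convexHull_image (fun i hi => (hw0 i hi).le) hw1
  obtain ⟨g, hg, hg0, hg1, hgz⟩ := exists_weights_of_mem_convexHull_image hx (key hv hw)
  have key2 : ∀ {v : ℕ →₀ ℝ}, IsBarycentric x F z v → g.support ⊆ v.support → v = g := by
    rintro u ⟨hs, hu0, hu1, huz⟩ hgu
    have hg1' := sum_support_weights hg
    have hgz' := sum_subset_support hg x
    have := hF.eq_zero_of_sum_eq_zero hx (u := fun i => u i - g i) hs ?_ ?_
    · ext i
      by_cases hi : i ∈ u.support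
      · exact sub_eq_zero.1 (this i hi)
      · rw [Finsupp.notMem_support_iff.1 hi,
          Finsupp.notMem_support_iff.1 fun h => hi (hgu h)]
    · rw [Finset.sum_sub_distrib, hu1, ← sum_support_weights hgu, hg1', hg1, sub_self]
    · simp_rw [sub_smul]
      rw [Finset.sum_sub_distrib, huz, ← sum_subset_support hgu, hgz', hgz, sub_self]
  rw [key2 hv (hg.trans Finset.inter_subset_left), key2 hw (hg.trans Finset.inter_subset_right)]

end IsSimplicialTiling

open Classical in
/-- The barycentric coordinates of `z` with respect to the vertices `x` of the tiling `F`. -/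
noncomputable def bary (x : ℕ → Fin D → ℝ) (F : Set (Finset (Fin D → ℝ))) (z : Fin D → ℝ) :
    ℕ →₀ ℝ :=
  if h : ∃ α, IsBarycentric x F z α then h.choose else 0

namespace IsSimplicialTiling

theorem isBarycentric_bary (hF : IsSimplicialTiling F Set.univ)
    (hx : EnumeratesVertices x F) (z : Fin D → ℝ) : IsBarycentric x F z (bary x F z) := by
  have h : ∃ α, IsBarycentric x F z α := by
    obtain ⟨s, hs, hz⟩ := hF.mem_iff.1 (Set.mem_univ z)
    obtain ⟨I, hI⟩ := hF.exists_index hx hs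
    rw [hI] at hz
    obtain ⟨w, hw, h0, h1, rfl⟩ := exists_weights_of_mem_convexHull_image hx.1 hz
    exact ⟨w, hF.isBarycentric_of_support_subset ⟨s, hs, hI⟩ hw h0 h1⟩
  rw [bary, dif_pos h]
  exact h.choose_spec

theorem bary_sum (hF : IsSimplicialTiling F Set.univ)
    (hx : EnumeratesVertices x F) {I : Finset ℕ} (hI : I ∈ indexFaces x F) {w : ℕ →₀ ℝ}
    (hw : w.support ⊆ I)
    (h0 : ∀ i, 0 ≤ w i) (h1 : ∑ i ∈ I, w i = 1) : bary x F (∑ i ∈ I, w i • x i) = w :=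
  hF.isBarycentric_unique hx.1 (hF.isBarycentric_bary hx _)
    (hF.isBarycentric_of_support_subset hI hw h0 h1)

theorem support_bary_subset (hF : IsSimplicialTiling F Set.univ)
    (hx : EnumeratesVertices x F) {I : Finset ℕ} (hI : I ∈ indexFaces x F) {z : Fin D → ℝ}
    (hz : z ∈ convexHull ℝ (x '' (I : Set ℕ))) : (bary x F z).support ⊆ I := by
  obtain ⟨w, hw, h0, h1, rfl⟩ := exists_weights_of_mem_convexHull_image hx.1 hz
  rwa [hF.bary_sum hx hI hw h0 h1]

theorem bary_nonneg (hF : IsSimplicialTiling F Set.univ)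
    (hx : EnumeratesVertices x F) (z : Fin D → ℝ) (i : ℕ) : 0 ≤ bary x F z i := by
  by_cases h : i ∈ (bary x F z).support
  · exact ((hF.isBarycentric_bary hx z).2.1 i h).le
  · rw [Finsupp.notMem_support_iff.1 h]

theorem bary_le_one (hF : IsSimplicialTiling F Set.univ)
    (hx : EnumeratesVertices x F) (z : Fin D → ℝ) (i : ℕ) : bary x F z i ≤ 1 := by
  by_cases h : i ∈ (bary x F z).support
  · rw [← (hF.isBarycentric_bary hx z).2.2.1]
    exact Finset.single_le_sum (fun j _ => hF.bary_nonneg hx z j) h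
  · rw [Finsupp.notMem_support_iff.1 h]
    exact zero_le_one

theorem bary_injective (hF : IsSimplicialTiling F Set.univ)
    (hx : EnumeratesVertices x F) : Function.Injective (bary x F) := by
  intro y z h
  rw [← (hF.isBarycentric_bary hx y).2.2.2, ← (hF.isBarycentric_bary hx z).2.2.2, h]

theorem perturbationMap_eq (hF : IsSimplicialTiling F Set.univ)
    (hx : EnumeratesVertices x F) (ε : ℕ → Fin D → ℝ) (z : Fin D → ℝ) :
    perturbationMap x F ε z = ∑ i ∈ (bary x F z).support, bary x F z i • (x i + ε i) := by
  have h : ∃ α, IsBarycentric x F z α := ⟨_, hF.isBarycentric_bary hx z⟩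
  have : bary x F z = h.choose := by rw [bary, dif_pos h]
  rw [perturbationMap, dif_pos h, this]

theorem perturbationMap_eq_id_add (hF : IsSimplicialTiling F Set.univ)
    (hx : EnumeratesVertices x F) (ε : ℕ → Fin D → ℝ) (z : Fin D → ℝ) :
    perturbationMap x F ε z = z + ∑ i ∈ (bary x F z).support, bary x F z i • ε i := by
  rw [hF.perturbationMap_eq hx]
  simp_rw [smul_add]
  rw [Finset.sum_add_distrib, (hF.isBarycentric_bary hx z).2.2.2]

/-- On one simplex the barycentric coordinates, hence the map, respect convex combinations. The
image is therefore convex, and it contains the moved vertices. -/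
theorem perturbationMap_image (hF : IsSimplicialTiling F Set.univ)
    (hx : EnumeratesVertices x F) (ε : ℕ → Fin D → ℝ) {I : Finset ℕ} (hI : I ∈ indexFaces x F) :
    perturbationMap x F ε '' convexHull ℝ (x '' (I : Set ℕ)) =
      convexHull ℝ ((fun i => x i + ε i) '' (I : Set ℕ)) := by
  classical
  apply Set.Subset.antisymm
  · rintro _ ⟨z, hz, rfl⟩
    have hsub := hF.support_bary_subset hx hI hz
    rw [hF.perturbationMap_eq hx, sum_subset_support hsub (fun i => x i + ε i)]
    refine sum_smul_mem_convexHull_image (y := fun i => x i + ε i)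
      (fun i _ => hF.bary_nonneg hx z i) ?_
    rw [← sum_support_weights hsub, (hF.isBarycentric_bary hx z).2.2.1]
  · apply convexHull_min
    · rintro _ ⟨i, hi, rfl⟩
      refine ⟨x i, subset_convexHull ℝ _ (Set.mem_image_of_mem x hi), ?_⟩
      have hsub : (Finsupp.single i (1 : ℝ)).support ⊆ I :=
        Finsupp.support_single_subset.trans (Finset.singleton_subset_iff.2 hi)
      have h1 : ∑ j ∈ I, (Finsupp.single i (1 : ℝ)) j • x j = x i := by
        rw [← sum_subset_support hsub, Finsupp.support_single i one_ne_zero]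
        simp
      have := hF.bary_sum hx hI hsub (fun j => by
        rw [Finsupp.single_apply]; split_ifs <;> norm_num) (by
        rw [← sum_support_weights hsub, Finsupp.support_single i one_ne_zero]; simp)
      rw [h1] at this
      rw [hF.perturbationMap_eq hx, this, Finsupp.support_single i one_ne_zero]
      simp
    · rintro _ ⟨y, hy, rfl⟩ _ ⟨z, hz, rfl⟩ a b ha hb hab
      refine ⟨a • y + b • z, convex_convexHull ℝ _ hy hz ha hb hab, ?_⟩
      have hy' := hF.support_bary_subset hx hI hy
      have hz' := hF.support_bary_subset hx hI hz
      have hsub : (a • bary x F y + b • bary x F z).support ⊆ I :=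
        Finsupp.support_add.trans (Finset.union_subset
          (Finsupp.support_smul.trans hy') (Finsupp.support_smul.trans hz'))
      have hsum : ∀ v : ℕ → Fin D → ℝ, ∑ i ∈ I, (a • bary x F y + b • bary x F z) i • v i =
          a • ∑ i ∈ (bary x F y).support, bary x F y i • v i +
          b • ∑ i ∈ (bary x F z).support, bary x F z i • v i := by
        intro v
        rw [sum_subset_support hy', sum_subset_support hz', Finset.smul_sum, Finset.smul_sum,
          ← Finset.sum_add_distrib]
        exact Finset.sum_congr rfl fun i _ => by
          simp only [Finsupp.add_apply, Finsupp.smul_apply, smul_eq_mul, add_smul, mul_smul]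
      have hb' := hF.bary_sum hx hI hsub (fun i => by
        have := hF.bary_nonneg hx y i
        have := hF.bary_nonneg hx z i
        simp only [Finsupp.add_apply, Finsupp.smul_apply, smul_eq_mul]
        positivity) (by
        simp only [Finsupp.add_apply, Finsupp.smul_apply, smul_eq_mul]
        rw [Finset.sum_add_distrib, ← Finset.mul_sum, ← Finset.mul_sum,
          ← sum_support_weights hy', ← sum_support_weights hz',
          (hF.isBarycentric_bary hx y).2.2.1, (hF.isBarycentric_bary hx z).2.2.1]
        simpa using hab)
      rw [hsum, (hF.isBarycentric_bary hx y).2.2.2, (hF.isBarycentric_bary hx z).2.2.2] at hb'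
      rw [hF.perturbationMap_eq hx, hb', sum_subset_support hsub (fun i => x i + ε i), hsum,
        hF.perturbationMap_eq hx, hF.perturbationMap_eq hx]

end IsSimplicialTiling

/-! ### Lipschitz bounds and the existence of an admissible radius. -/

/-- A map which is pointwise `L`-Lipschitz near every point is `L`-Lipschitz. -/
theorem norm_sub_le_of_eventually {E V : Type*} [NormedAddCommGroup E] [NormedSpace ℝ E]
    [NormedAddCommGroup V] {g : E → V} {L : ℝ}
    (h : ∀ z, ∀ᶠ z' in 𝓝 z, ‖g z' - g z‖ ≤ L * ‖z' - z‖) (a b : E) :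
    ‖g b - g a‖ ≤ L * ‖b - a‖ := by
  have hcont : Continuous g := by
    rw [continuous_iff_continuousAt]
    intro z
    rw [ContinuousAt, tendsto_iff_norm_sub_tendsto_zero]
    have h0 : Tendsto (fun z' => L * ‖z' - z‖) (𝓝 z) (𝓝 0) := by
      have : Continuous fun z' => L * ‖z' - z‖ := by fun_prop
      simpa using this.tendsto z
    exact squeeze_zero' (Eventually.of_forall fun _ => norm_nonneg _) (h z) h0
  set p : ℝ → E := fun t => a + t • (b - a) with hp
  have hpc : Continuous p := by fun_prop
  -- Continuous induction along the segment: the set of times satisfying the bound is closed and, by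
  -- the local estimate, can always be extended to the right.
  set s : Set ℝ := {t | ‖g (p t) - g a‖ ≤ L * (t * ‖b - a‖)} with hs
  have hcl : IsClosed s := isClosed_le (by fun_prop) (by fun_prop)
  have hsub : Set.Icc (0 : ℝ) 1 ⊆ s := by
    refine (hcl.inter isClosed_Icc).Icc_subset_of_forall_exists_gt (by simp [hs, hp]) ?_
    rintro t ⟨ht, ht01⟩ y hy
    have h1 : ∀ᶠ t' in 𝓝[>] t, ‖g (p t') - g (p t)‖ ≤ L * ‖p t' - p t‖ :=
      (hpc.continuousAt.tendsto.eventually (h (p t))).filter_mono nhdsWithin_le_nhds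
    have h2 : ∀ᶠ t' in 𝓝[>] t, t' ∈ Set.Ioc t y := Ioc_mem_nhdsGT hy
    obtain ⟨t', h1, h2⟩ := (h1.and h2).exists
    refine ⟨t', ?_, h2⟩
    have h3 : ‖p t' - p t‖ = (t' - t) * ‖b - a‖ := by
      rw [show p t' - p t = (t' - t) • (b - a) by simp only [hp]; module, norm_smul,
        Real.norm_of_nonneg (sub_nonneg.2 h2.1.le)]
    rw [h3] at h1
    calc ‖g (p t') - g a‖ ≤ ‖g (p t') - g (p t)‖ + ‖g (p t) - g a‖ :=
          norm_sub_le_norm_sub_add_norm_sub _ _ _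
      _ ≤ L * ((t' - t) * ‖b - a‖) + L * (t * ‖b - a‖) := add_le_add h1 ht
      _ = L * (t' * ‖b - a‖) := by ring
  have := hsub (Set.right_mem_Icc.2 zero_le_one)
  simpa [hs, hp] using this

/-- Near every point, `F` is covered by finitely many of its simplices. -/
def IsLocallyFiniteCover (F : Set (Finset (Fin D → ℝ))) : Prop :=
  ∀ z : Fin D → ℝ, ∃ A : Set (Finset (Fin D → ℝ)), A.Finite ∧ A ⊆ F ∧
    ∀ᶠ z' in 𝓝 z, ∃ s ∈ A, z' ∈ convexHull ℝ (s : Set (Fin D → ℝ))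

/-- On every simplex of `F`, the barycentric coordinates are `L`-Lipschitz (in `ℓ¹` norm). -/
def IsUniformlyNondegenerate (F : Set (Finset (Fin D → ℝ))) (L : ℝ) : Prop :=
  ∀ s ∈ F, ∀ u : (Fin D → ℝ) → ℝ, ∑ v ∈ s, u v = 0 → ∑ v ∈ s, |u v| ≤ L * ‖∑ v ∈ s, u v • v‖

theorem IsUniformlyNondegenerate.index {L : ℝ} (hU : IsUniformlyNondegenerate F L)
    (hx : Function.Injective x) {I : Finset ℕ} (hI : I ∈ indexFaces x F) {u : ℕ → ℝ}
    (hu : ∑ i ∈ I, u i = 0) : ∑ i ∈ I, |u i| ≤ L * ‖∑ i ∈ I, u i • x i‖ := by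
  classical
  obtain ⟨s, hs, hsI⟩ := hI
  have hsI' : s = I.image x := by
    apply Finset.coe_injective
    rw [hsI, Finset.coe_image]
  have hinv : ∀ i, Function.invFun x (x i) = i := Function.leftInverse_invFun hx
  have := hU s hs (u ∘ Function.invFun x)
  rw [hsI', Finset.sum_image hx.injOn, Finset.sum_image hx.injOn, Finset.sum_image hx.injOn] at this
  simpa [hinv, hu] using this

namespace IsSimplicialTiling

/-- Near a given point, only vertices of finitely many covering simplices can carry weight. -/
theorem locallyFinite_support_bary (hF : IsSimplicialTiling F Set.univ)
    (hx : EnumeratesVertices x F) (hLF : IsLocallyFiniteCover F) :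
    LocallyFinite fun i => Function.support fun z => bary x F z i := by
  intro z
  obtain ⟨A, hA, hAF, hz⟩ := hLF z
  refine ⟨_, hz, ?_⟩
  have hfin : (⋃ s ∈ A, x ⁻¹' (s : Set (Fin D → ℝ))).Finite :=
    hA.biUnion fun s _ => s.finite_toSet.preimage hx.1.injOn
  refine hfin.subset ?_
  rintro i ⟨y, hy, s, hsA, hys⟩
  obtain ⟨I, hI⟩ := hF.exists_index hx (hAF hsA)
  have h1 := hF.support_bary_subset hx ⟨s, hAF hsA, hI⟩ (hI ▸ hys)
  have h2 : i ∈ I := h1 (Finsupp.mem_support_iff.2 hy)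
  refine Set.mem_biUnion hsA ?_
  rw [Set.mem_preimage, hI]
  exact Set.mem_image_of_mem x h2

/-- Points close to `z` share a simplex with `z`, where nondegeneracy controls the `ℓ¹` change of
the weights; local bounds then globalize along segments. General values `e` serve both the
perturbation (`e = ε`) and single coordinates (`e` an indicator). -/
theorem norm_bary_sum_sub_le (hF : IsSimplicialTiling F Set.univ)
    (hx : EnumeratesVertices x F) {V : Type*} [NormedAddCommGroup V] [NormedSpace ℝ V] {L : ℝ}
    (hLF : IsLocallyFiniteCover F) (hU : IsUniformlyNondegenerate F L) {e : ℕ → V}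
    {ρ : ℝ} (hρ : ∀ i, ‖e i‖ ≤ ρ) (y z : Fin D → ℝ) :
    ‖∑ i ∈ (bary x F y).support, bary x F y i • e i -
      ∑ i ∈ (bary x F z).support, bary x F z i • e i‖ ≤ ρ * L * ‖y - z‖ := by
  have hρ0 : 0 ≤ ρ := (norm_nonneg _).trans (hρ 0)
  refine norm_sub_le_of_eventually
    (g := fun y => ∑ i ∈ (bary x F y).support, bary x F y i • e i) ?_ z y
  intro z
  obtain ⟨A, hA, hAF, hz⟩ := hLF z
  -- Simplices are closed, so the finitely many in `A` that miss `z` also miss a neighbourhood of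
  -- `z`.
  have h2 : ∀ᶠ z' in 𝓝 z, ∀ s ∈ A, z ∉ convexHull ℝ (s : Set (Fin D → ℝ)) →
      z' ∉ convexHull ℝ (s : Set (Fin D → ℝ)) := by
    rw [eventually_all_finite hA]
    intro s _
    by_cases h : z ∈ convexHull ℝ (s : Set (Fin D → ℝ))
    · exact Eventually.of_forall fun _ h' => absurd h h'
    · have : IsClosed (convexHull ℝ (s : Set (Fin D → ℝ))) :=
        s.finite_toSet.isClosed_convexHull ℝ
      filter_upwards [this.isOpen_compl.mem_nhds h] with z' hz' _
      exact hz'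
  filter_upwards [hz, h2] with z' ⟨s, hsA, hs⟩ h2
  have hzs : z ∈ convexHull ℝ (s : Set (Fin D → ℝ)) := by
    by_contra h
    exact h2 s hsA h hs
  obtain ⟨I, hI⟩ := hF.exists_index hx (hAF hsA)
  have hIF : I ∈ indexFaces x F := ⟨s, hAF hsA, hI⟩
  have hz1 := hF.support_bary_subset hx hIF (hI ▸ hzs)
  have hz1' := hF.support_bary_subset hx hIF (hI ▸ hs)
  have hu := hU.index hx.1 hIF (u := fun i => bary x F z' i - bary x F z i) (by
    rw [Finset.sum_sub_distrib, ← sum_support_weights hz1, ← sum_support_weights hz1',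
      (hF.isBarycentric_bary hx z).2.2.1, (hF.isBarycentric_bary hx z').2.2.1, sub_self])
  simp_rw [sub_smul] at hu
  rw [Finset.sum_sub_distrib, ← sum_subset_support hz1, ← sum_subset_support hz1',
    (hF.isBarycentric_bary hx z).2.2.2, (hF.isBarycentric_bary hx z').2.2.2] at hu
  rw [sum_subset_support hz1, sum_subset_support hz1', ← Finset.sum_sub_distrib]
  calc ‖∑ i ∈ I, (bary x F z' i • e i - bary x F z i • e i)‖
      ≤ ∑ i ∈ I, |bary x F z' i - bary x F z i| * ρ := by
        refine norm_sum_le_of_le _ fun i _ => ?_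
        rw [← sub_smul, norm_smul, Real.norm_eq_abs]
        exact mul_le_mul_of_nonneg_left (hρ i) (abs_nonneg _)
    _ = ρ * ∑ i ∈ I, |bary x F z' i - bary x F z i| := by rw [← Finset.sum_mul, mul_comm]
    _ ≤ ρ * (L * ‖z' - z‖) := mul_le_mul_of_nonneg_left hu hρ0
    _ = ρ * L * ‖z' - z‖ := by ring

theorem continuous_bary (hF : IsSimplicialTiling F Set.univ)
    (hx : EnumeratesVertices x F) {L : ℝ} (hL : 0 ≤ L) (hLF : IsLocallyFiniteCover F)
    (hU : IsUniformlyNondegenerate F L) (i : ℕ) : Continuous fun z => bary x F z i := by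
  classical
  have key : ∀ z, ∑ j ∈ (bary x F z).support, bary x F z j • (if j = i then (1 : ℝ) else 0) =
      bary x F z i := by
    intro z
    simp only [smul_eq_mul, mul_ite, mul_one, mul_zero, Finset.sum_ite_eq',
      Finsupp.mem_support_iff, ite_not]
    split_ifs with h
    · exact h.symm
    · rfl
  have : LipschitzWith (1 * L).toNNReal fun z => bary x F z i := by
    refine LipschitzWith.of_dist_le_mul fun y z => ?_
    rw [dist_eq_norm, dist_eq_norm, ← key y, ← key z,
      Real.coe_toNNReal _ (mul_nonneg zero_le_one hL)]
    refine hF.norm_bary_sum_sub_le hx hLF hU (fun j => ?_) y z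
    split_ifs <;> simp
  exact this.continuous

/-- The map differs from the identity by a `1/2`-Lipschitz map, so the global inverse function
theorem for maps close to a linear isomorphism applies. -/
theorem isHomeomorph_perturbationMap (hF : IsSimplicialTiling F Set.univ)
    (hx : EnumeratesVertices x F) {L : ℝ} (hLF : IsLocallyFiniteCover F)
    (hU : IsUniformlyNondegenerate F L) {ε : ℕ → Fin D → ℝ} {ρ : ℝ} (hρ : ∀ i, ‖ε i‖ ≤ ρ)
    (hρL : ρ * L ≤ 1 / 2) : IsHomeomorph (perturbationMap x F ε) := by
  have happ : ApproximatesLinearOn (perturbationMap x F ε)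
      ((ContinuousLinearEquiv.refl ℝ (Fin D → ℝ) : (Fin D → ℝ) ≃L[ℝ] (Fin D → ℝ)) :
        (Fin D → ℝ) →L[ℝ] (Fin D → ℝ)) Set.univ (1 / 2 : NNReal) := by
    intro y _ z _
    have := hF.norm_bary_sum_sub_le hx hLF hU hρ y z
    rw [hF.perturbationMap_eq_id_add hx, hF.perturbationMap_eq_id_add hx]
    simp only [ContinuousLinearEquiv.coe_refl, ContinuousLinearMap.coe_id', id_eq]
    rw [show ∀ a b : Fin D → ℝ, y + a - (z + b) - (y - z) = a - b by intros; abel]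
    refine this.trans ?_
    push_cast
    exact mul_le_mul_of_nonneg_right hρL (norm_nonneg _)
  have hc : Subsingleton (Fin D → ℝ) ∨ (1 / 2 : NNReal) <
      ‖((ContinuousLinearEquiv.refl ℝ (Fin D → ℝ)).symm :
        (Fin D → ℝ) →L[ℝ] (Fin D → ℝ))‖₊⁻¹ := by
    rcases subsingleton_or_nontrivial (Fin D → ℝ) with h | h
    · exact Or.inl h
    · right
      have : ‖((ContinuousLinearEquiv.refl ℝ (Fin D → ℝ)).symm :
        (Fin D → ℝ) →L[ℝ] (Fin D → ℝ))‖₊ = 1 := by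
        simp [ContinuousLinearMap.nnnorm_id]
      rw [this, inv_one]
      exact NNReal.half_lt_self one_ne_zero
  exact (happ.toHomeomorph _ hc).isHomeomorph

/-- The bijection maps each old simplex onto the moved one, which transports intersections and
covering. Affine independence comes from the smallness of the noise instead. -/
theorem perturbed (hF : IsSimplicialTiling F Set.univ)
    (hx : EnumeratesVertices x F) {L : ℝ} (hU : IsUniformlyNondegenerate F L)
    {ε : ℕ → Fin D → ℝ} {ρ : ℝ} (hρ : ∀ i, ‖ε i‖ ≤ ρ)
    (hρL : ρ * L ≤ 1 / 2) (hbij : Function.Bijective (perturbationMap x F ε)) :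
    IsSimplicialTiling (perturbedFaces x F ε) Set.univ := by
  classical
  have hvert : ∀ i, perturbationMap x F ε (x i) = x i + ε i := by
    intro i
    have hi : {i} ∈ indexFaces x F := by
      have : x i ∈ {v | {v} ∈ F} := hx.2 ▸ Set.mem_range_self i
      exact ⟨{x i}, this, by simp⟩
    have := hF.perturbationMap_image hx ε hi
    simpa using this
  have hyinj : Function.Injective fun i => x i + ε i := by
    intro i j hij
    simp only [← hvert] at hij
    exact hx.1 (hbij.1 hij)
  have hhull : ∀ {I : Finset ℕ} {t : Finset (Fin D → ℝ)}, I ∈ indexFaces x F →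
      (t : Set (Fin D → ℝ)) = (fun i => x i + ε i) '' (I : Set ℕ) →
      convexHull ℝ (t : Set (Fin D → ℝ)) =
        perturbationMap x F ε '' convexHull ℝ (x '' (I : Set ℕ)) := by
    intro I t hI ht
    rw [ht, hF.perturbationMap_image hx ε hI]
  have hρ0 : 0 ≤ ρ := (norm_nonneg _).trans (hρ 0)
  refine ⟨⟨⟨perturbedFaces x F ε, ?_⟩, ?_, ?_⟩, rfl, ?_, ?_⟩
  · rintro t ⟨I, ⟨s, hs, hsI⟩, htI⟩
    constructor
    · have h1 := hF.nonempty hs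
      rw [← Finset.coe_nonempty, hsI, Set.image_nonempty] at h1
      rw [← Finset.coe_nonempty, htI]
      exact h1.image _
    · intro t' htt' ht'
      have hJ : (t' : Set (Fin D → ℝ)) = (fun i => x i + ε i) ''
          ((I.filter fun i => x i + ε i ∈ t' : Finset ℕ) : Set ℕ) := by
        ext v
        simp only [Finset.mem_coe, Set.mem_image, Finset.coe_filter, Set.mem_ofPred_eq]
        constructor
        · intro hv
          have : v ∈ (t : Set (Fin D → ℝ)) := htt' hv
          rw [htI] at this
          obtain ⟨i, hi, rfl⟩ := this
          exact ⟨i, ⟨hi, hv⟩, rfl⟩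
        · rintro ⟨i, ⟨_, hi⟩, rfl⟩
          exact hi
      refine ⟨_, hF.mem_indexFaces_of_subset ⟨s, hs, hsI⟩ (Finset.filter_subset _ I) ?_, hJ⟩
      rw [← Finset.coe_nonempty, hJ, Set.image_nonempty] at ht'
      exact_mod_cast ht'
  · rintro t ⟨I, hI, htI⟩
    have hy : AffineIndependent ℝ fun i : I => x i + ε i := by
      rw [affineIndependent_iff_of_fintype]
      intro w hw0 hw1
      rw [Finset.univ.weightedVSub_eq_linear_combination hw0] at hw1
      let u : ℕ → ℝ := fun i => if h : i ∈ I then w ⟨i, h⟩ else 0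
      have hu : ∀ i : I, u i = w i := fun i => by simp [u]
      simp_rw [← hu] at hw0 hw1
      rw [Finset.univ_eq_attach, Finset.sum_attach I u] at hw0
      rw [Finset.univ_eq_attach, Finset.sum_attach I fun i => u i • (x i + ε i)] at hw1
      have h1 := hU.index hx.1 hI hw0
      have h2 : ‖∑ i ∈ I, u i • ε i‖ ≤ ρ * ∑ i ∈ I, |u i| := by
        rw [mul_comm, Finset.sum_mul]
        refine norm_sum_le_of_le _ fun i _ => ?_
        rw [norm_smul, Real.norm_eq_abs]
        exact mul_le_mul_of_nonneg_left (hρ i) (abs_nonneg _)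
      simp_rw [smul_add] at hw1
      rw [Finset.sum_add_distrib, add_eq_zero_iff_eq_neg] at hw1
      have h3 : ‖∑ i ∈ I, u i • x i‖ = ‖∑ i ∈ I, u i • ε i‖ := by rw [hw1, norm_neg]
      -- An affine dependence `u` of the moved vertices has `‖∑ u i • x i‖ = ‖∑ u i • ε i‖`, which
      -- is at most half of itself and so vanishes.
      have h4 : ρ * ∑ i ∈ I, |u i| ≤ 1 / 2 * ‖∑ i ∈ I, u i • x i‖ :=
        calc ρ * ∑ i ∈ I, |u i| ≤ ρ * (L * ‖∑ i ∈ I, u i • x i‖) :=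
              mul_le_mul_of_nonneg_left h1 hρ0
          _ = ρ * L * ‖∑ i ∈ I, u i • x i‖ := by ring
          _ ≤ _ := mul_le_mul_of_nonneg_right hρL (norm_nonneg _)
      have h5 : ‖∑ i ∈ I, u i • x i‖ ≤ 0 := by linarith
      have h6 := hF.eq_zero_of_sum_eq_zero hx.1 hI hw0 (norm_le_zero_iff.1 h5)
      intro i
      rw [← hu]
      exact h6 i i.2
    have hr := hy.range
    have : Set.range (fun i : I => x i + ε i) = (t : Set (Fin D → ℝ)) := by
      rw [htI]
      ext v
      simp
    rw [this] at hr
    exact hr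
  · rintro t t' ⟨I, hI, htI⟩ ⟨I', hI', htI'⟩ p ⟨hp, hp'⟩
    rw [hhull hI htI] at hp
    rw [hhull hI' htI'] at hp'
    obtain ⟨a, ha, rfl⟩ := hp
    obtain ⟨a', ha', haa'⟩ := hp'
    obtain rfl := hbij.1 haa'
    obtain ⟨s, hs, hsI⟩ := id hI
    obtain ⟨s', hs', hsI'⟩ := id hI'
    have h1 := hF.inter_subset hs hs' ⟨hsI ▸ ha, hsI' ▸ ha'⟩
    rw [hsI, hsI', ← Set.image_inter hx.1, ← Finset.coe_inter] at h1
    have hne : (I ∩ I').Nonempty := by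
      have := convexHull_nonempty_iff.1 ⟨_, h1⟩
      rw [Set.image_nonempty] at this
      exact_mod_cast this
    have h2 := hF.mem_indexFaces_of_subset hI Finset.inter_subset_left hne
    have h3 := Set.mem_image_of_mem (perturbationMap x F ε) h1
    rw [hF.perturbationMap_image hx ε h2, Finset.coe_inter, Set.image_inter hyinj, ← htI,
      ← htI'] at h3
    exact h3
  · rintro t ⟨I, ⟨s, hs, hsI⟩, htI⟩
    obtain ⟨K, hK, hface, -⟩ := id hF
    obtain ⟨s', hs', hss', hcard⟩ := hface s hs
    obtain ⟨I', hI'⟩ := hF.exists_index hx hs'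
    refine ⟨I'.image fun i => x i + ε i, ⟨I', ⟨s', hs', hI'⟩, Finset.coe_image⟩, ?_, ?_⟩
    · rw [← Finset.coe_subset, htI, Finset.coe_image]
      apply Set.image_mono
      have : x '' (I : Set ℕ) ⊆ x '' (I' : Set ℕ) := by
        rw [← hsI, ← hI']
        exact_mod_cast hss'
      exact (Set.image_subset_image_iff hx.1).1 this
    · rw [Finset.card_image_of_injective _ hyinj, ← hcard, ← Finset.card_image_of_injective I' hx.1]
      congr 1
      apply Finset.coe_injective
      rw [Finset.coe_image, hI']
  · rw [Set.eq_univ_iff_forall]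
    intro p
    obtain ⟨z, rfl⟩ := hbij.2 p
    obtain ⟨s, hs, hz⟩ := hF.mem_iff.1 (Set.mem_univ z)
    obtain ⟨I, hI⟩ := hF.exists_index hx hs
    rw [Geometry.SimplicialComplex.mem_space_iff]
    refine ⟨I.image fun i => x i + ε i, ⟨I, ⟨s, hs, hI⟩, Finset.coe_image⟩, ?_⟩
    rw [hhull ⟨s, hs, hI⟩ Finset.coe_image, ← hI]
    exact Set.mem_image_of_mem _ hz

end IsSimplicialTiling

theorem exists_isAdmissibleRadius (hF : IsSimplicialTiling F Set.univ)
    (hx : EnumeratesVertices x F) {L : ℝ} (hL : 0 ≤ L) (hLF : IsLocallyFiniteCover F)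
    (hU : IsUniformlyNondegenerate F L) : ∃ r₀, IsAdmissibleRadius x F r₀ := by
  -- This makes `ρ * L ≤ 1 / 2`; using `L + 1` keeps the radius positive and finite even when `L =
  -- 0`.
  refine ⟨1 / (2 * (L + 1)), by positivity, fun ε hε => ?_⟩
  have hρ : ∀ i, ‖ε i‖ ≤ 1 / (2 * (L + 1)) := by
    intro i
    rw [pi_norm_le_iff_of_nonneg (by positivity)]
    intro j
    rw [Real.norm_eq_abs, abs_le]
    exact ⟨(hε i).1 j, (hε i).2 j⟩
  have hρL : 1 / (2 * (L + 1)) * L ≤ 1 / 2 := by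
    rw [div_mul_eq_mul_div, div_le_div_iff₀ (by positivity) (by positivity)]
    linarith
  have h := hF.isHomeomorph_perturbationMap hx hLF hU hρ hρL
  exact ⟨hF.perturbed hx hU hρ hρL h.bijective, h⟩

end Barycentric

/-! ### The mirrored tiling: gluing, local finiteness, uniform nondegeneracy, enumeration of
vertices. -/

section Mirror

variable {D : ℕ} {x : ℕ → Fin D → ℝ} {F₀ : Set (Finset (Fin D → ℝ))}

/-- The sign with which `mirrorMap k` acts along each axis. -/
def mirrorSign (k : Fin D → ℤ) : Fin D → ℝ := fun i => if Even (k i) then 1 else -1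

theorem abs_mirrorSign (k : Fin D → ℤ) (i : Fin D) : |mirrorSign k i| = 1 := by
  unfold mirrorSign
  split_ifs <;> simp

theorem mirrorMap_eq (k : Fin D → ℤ) (z : Fin D → ℝ) :
    mirrorMap k z = mirrorSign k * z + mirrorMap k 0 := by
  ext i
  simp only [mirrorMap, mirrorSign, Pi.add_apply, Pi.mul_apply, Pi.zero_apply]
  split_ifs <;> ring

/-- `mirrorMap k` as an affine map. -/
noncomputable def mirrorAffine (k : Fin D → ℤ) : (Fin D → ℝ) →ᵃ[ℝ] (Fin D → ℝ) where
  toFun := mirrorMap k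
  linear := LinearMap.mulLeft ℝ (mirrorSign k)
  map_vadd' p v := by
    rw [mirrorMap_eq, mirrorMap_eq k p]
    simp only [vadd_eq_add, LinearMap.mulLeft_apply]
    ring

theorem coe_mirrorAffine (k : Fin D → ℤ) : ⇑(mirrorAffine k) = mirrorMap k := rfl

theorem mirrorMap_image_convexHull (k : Fin D → ℤ) (s : Set (Fin D → ℝ)) :
    mirrorMap k '' convexHull ℝ s = convexHull ℝ (mirrorMap k '' s) := by
  rw [← coe_mirrorAffine, AffineMap.image_convexHull]

theorem mirrorMap_injective (k : Fin D → ℤ) : Function.Injective (mirrorMap k) := by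
  intro y z h
  ext i
  have := congrFun h i
  simp only [mirrorMap] at this
  split_ifs at this <;> linarith

theorem norm_mirrorSign_mul (k : Fin D → ℤ) (z : Fin D → ℝ) : ‖mirrorSign k * z‖ = ‖z‖ := by
  simp only [Pi.norm_def]
  congr 1
  refine Finset.sup_congr rfl fun i _ => ?_
  ext
  simp [abs_mirrorSign]

theorem exists_mirrorMap_floor (z : Fin D → ℝ) :
    ∃ y ∈ Set.Icc (0 : Fin D → ℝ) 1, mirrorMap (fun i => ⌊z i⌋) y = z := by
  refine ⟨fun i => if Even ⌊z i⌋ then z i - ⌊z i⌋ else 1 - (z i - ⌊z i⌋), ⟨?_, ?_⟩, ?_⟩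
  · intro i
    have h1 := Int.floor_le (z i)
    have h2 := Int.lt_floor_add_one (z i)
    simp only [Pi.zero_apply]
    split_ifs <;> linarith
  · intro i
    have h1 := Int.floor_le (z i)
    have h2 := Int.lt_floor_add_one (z i)
    simp only [Pi.one_apply]
    split_ifs <;> linarith
  · ext i
    simp only [mirrorMap]
    split_ifs <;> ring

/-- Cubes that meet have indices differing by at most one along each axis. Where they differ, the
reflection makes both cubes see the common facet at the same local coordinate, `0` or `1`; plain
translation would confuse the two. -/
theorem mirrorMap_coord_eq {k l : Fin D → ℤ} {a b : Fin D → ℝ} (ha : a ∈ Set.Icc (0 : Fin D → ℝ) 1)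
    (hb : b ∈ Set.Icc (0 : Fin D → ℝ) 1) (h : mirrorMap k a = mirrorMap l b) (i : Fin D) :
    a i = b i ∧ (k i = l i ∨ ((a i = 0 ∨ a i = 1) ∧
      ∀ c : Fin D → ℝ, c i = a i → mirrorMap k c i = mirrorMap l c i)) := by
  have h0 := congrFun h i
  have ha0 : 0 ≤ a i := ha.1 i
  have ha1 : a i ≤ 1 := ha.2 i
  have hb0 : 0 ≤ b i := hb.1 i
  have hb1 : b i ≤ 1 := hb.2 i
  have key : a i = b i ∧ (k i = l i ∨ (a i = 0 ∨ a i = 1)) := by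
    simp only [mirrorMap] at h0
    have hk : k i < l i + 1 + 1 := by
      have : (k i : ℝ) ≤ l i + 1 := by split_ifs at h0 <;> linarith
      have : k i ≤ l i + 1 := by exact_mod_cast this
      omega
    have hl : l i < k i + 1 + 1 := by
      have : (l i : ℝ) ≤ k i + 1 := by split_ifs at h0 <;> linarith
      have : l i ≤ k i + 1 := by exact_mod_cast this
      omega
    have : k i = l i ∨ k i = l i + 1 ∨ l i = k i + 1 := by omega
    rcases this with h1 | h1 | h1
    · rw [h1] at h0
      refine ⟨?_, Or.inl h1⟩
      split_ifs at h0 <;> linarith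
    · by_cases hev : Even (l i)
      · have hev' : ¬ Even (k i) := by rw [h1]; simpa [Int.even_add_one] using hev
        simp only [hev, hev', if_true, if_false] at h0
        rw [h1] at h0
        push_cast at h0
        have : a i = 1 := by linarith
        exact ⟨by linarith, Or.inr (Or.inr this)⟩
      · have hev' : Even (k i) := by rw [h1]; simpa [Int.even_add_one] using hev
        simp only [hev, hev', if_true, if_false] at h0
        rw [h1] at h0
        push_cast at h0
        have : a i = 0 := by linarith
        exact ⟨by linarith, Or.inr (Or.inl this)⟩
    · by_cases hev : Even (k i)
      · have hev' : ¬ Even (l i) := by rw [h1]; simpa [Int.even_add_one] using hev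
        simp only [hev, hev', if_true, if_false] at h0
        rw [h1] at h0
        push_cast at h0
        have : a i = 1 := by linarith
        exact ⟨by linarith, Or.inr (Or.inr this)⟩
      · have hev' : Even (l i) := by rw [h1]; simpa [Int.even_add_one] using hev
        simp only [hev, hev', if_true, if_false] at h0
        rw [h1] at h0
        push_cast at h0
        have : a i = 0 := by linarith
        exact ⟨by linarith, Or.inr (Or.inl this)⟩
  refine ⟨key.1, key.2.imp_right fun h1 => ⟨h1, fun c hc => ?_⟩⟩
  have h2 : mirrorMap k c i = mirrorMap k a i := by simp only [mirrorMap, hc]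
  have h3 : mirrorMap l c i = mirrorMap l b i := by simp only [mirrorMap, hc, key.1]
  rw [h2, h3, h0]

/-- In a convex combination with positive weights of numbers in `[0, 1]` whose value is `0` or `1`,
all the numbers are equal to this value. -/
theorem eq_of_sum_eq_zero_or_one {ι : Type*} {s : Finset ι} {w c : ι → ℝ} {a : ℝ}
    (hw : ∀ j ∈ s, 0 < w j) (hw1 : ∑ j ∈ s, w j = 1) (hc : ∀ j ∈ s, c j ∈ Set.Icc (0 : ℝ) 1)
    (hs : ∑ j ∈ s, w j * c j = a) (ha : a = 0 ∨ a = 1) : ∀ j ∈ s, c j = a := by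
  rcases ha with rfl | rfl
  · rw [Finset.sum_eq_zero_iff_of_nonneg fun j hj => mul_nonneg (hw j hj).le (hc j hj).1] at hs
    intro j hj
    exact (mul_eq_zero.1 (hs j hj)).resolve_left (hw j hj).ne'
  · have h : ∑ j ∈ s, w j * (1 - c j) = 0 := by
      simp_rw [mul_sub, mul_one]
      rw [Finset.sum_sub_distrib, hw1, hs, sub_self]
    rw [Finset.sum_eq_zero_iff_of_nonneg
      fun j hj => mul_nonneg (hw j hj).le (sub_nonneg.2 (hc j hj).2)] at h
    intro j hj
    have := (mul_eq_zero.1 (h j hj)).resolve_left (hw j hj).ne'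
    linarith

theorem mirrorFaces_eq (F₀ : Set (Finset (Fin D → ℝ))) [DecidableEq (Fin D → ℝ)] :
    mirrorFaces F₀ = {t | ∃ k, ∃ s ∈ F₀, t = s.image (mirrorMap k)} := by
  ext t
  simp only [mirrorFaces, Set.mem_ofPred_eq, ← Finset.coe_image, Finset.coe_inj]

namespace IsSimplicialTiling

theorem convexHull_subset_cube (hF₀ : IsSimplicialTiling F₀ (Set.Icc 0 1))
    {s : Finset (Fin D → ℝ)} (hs : s ∈ F₀) :
    convexHull ℝ (s : Set (Fin D → ℝ)) ⊆ Set.Icc 0 1 :=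
  fun _ hz => hF₀.mem_iff.2 ⟨s, hs, hz⟩

theorem exists_mem_mirror_floor (hF₀ : IsSimplicialTiling F₀ (Set.Icc 0 1)) (z : Fin D → ℝ) :
    ∃ s ∈ F₀, z ∈ convexHull ℝ (mirrorMap (fun i => ⌊z i⌋) '' (s : Set (Fin D → ℝ))) := by
  obtain ⟨y, hy, hyz⟩ := exists_mirrorMap_floor z
  obtain ⟨s, hs, hys⟩ := hF₀.mem_iff.1 hy
  refine ⟨s, hs, ?_⟩
  rw [← mirrorMap_image_convexHull]
  exact ⟨y, hys, hyz⟩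

/-- Only intersections across cubes need an argument. A common point has the same local position `a`
in both cubes, and `a` is a combination of common vertices. On an axis where the cubes differ, `a`
lies on a facet of the unit cube, so the vertices carrying it do too, and there both mirror maps
agree. -/
theorem mirror (hF₀ : IsSimplicialTiling F₀ (Set.Icc 0 1)) :
    IsSimplicialTiling (mirrorFaces F₀) Set.univ := by
  classical
  rw [mirrorFaces_eq]
  refine ⟨⟨⟨{t | ∃ k, ∃ s ∈ F₀, t = s.image (mirrorMap k)}, ?_⟩, ?_, ?_⟩, rfl, ?_, ?_⟩
  · rintro _ ⟨k, s, hs, rfl⟩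
    refine ⟨(hF₀.nonempty hs).image _, fun t ht htn => ?_⟩
    have ht' : t = (s.filter fun v => mirrorMap k v ∈ t).image (mirrorMap k) := by
      ext v
      simp only [Finset.mem_image, Finset.mem_filter]
      constructor
      · intro hv
        obtain ⟨w, hw, rfl⟩ := Finset.mem_image.1 (ht hv)
        exact ⟨w, ⟨hw, hv⟩, rfl⟩
      · rintro ⟨w, ⟨_, hw⟩, rfl⟩
        exact hw
    refine ⟨k, _, hF₀.down_closed hs (Finset.filter_subset _ s) ?_, ht'⟩
    rw [ht'] at htn
    exact Finset.image_nonempty.1 htn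
  · rintro _ ⟨k, s, hs, rfl⟩
    have h := ((hF₀.indep hs).map' (mirrorAffine k) (mirrorMap_injective k)).range
    have h2 : Set.range (mirrorAffine k ∘ ((↑) : s → Fin D → ℝ)) =
        (s.image (mirrorMap k) : Finset (Fin D → ℝ)) := by
      rw [Set.range_comp, Subtype.range_coe, Finset.coe_image, coe_mirrorAffine]
    rw [h2] at h
    exact h
  · rintro _ _ ⟨k, s, hs, rfl⟩ ⟨l, t, ht, rfl⟩ p ⟨hp, hp'⟩
    rw [Finset.coe_image, ← mirrorMap_image_convexHull] at hp hp'
    obtain ⟨a, ha, rfl⟩ := hp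
    obtain ⟨b, hb, hab⟩ := hp'
    have hac := hF₀.convexHull_subset_cube hs ha
    have hbc := hF₀.convexHull_subset_cube ht hb
    have hcoord := mirrorMap_coord_eq hac hbc hab.symm
    obtain rfl : a = b := funext fun i => (hcoord i).1
    have hst := hF₀.inter_subset hs ht ⟨ha, hb⟩
    rw [← Finset.coe_inter, Finset.mem_convexHull'] at hst
    obtain ⟨w, hw0, hw1, hwa⟩ := hst
    -- Zero weights are discarded because only vertices of positive weight are forced onto the
    -- facet.
    set J := (s ∩ t).filter fun v => w v ≠ 0 with hJ
    have hJ1 : ∑ v ∈ J, w v = 1 := by rw [← hw1, hJ, Finset.sum_filter_ne_zero]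
    have hJa : ∑ v ∈ J, w v • v = a := by
      rw [← hwa, hJ]
      refine Finset.sum_subset (Finset.filter_subset _ _) fun v hv hv' => ?_
      have : w v = 0 := by
        by_contra h
        exact hv' (Finset.mem_filter.2 ⟨hv, h⟩)
      rw [this, zero_smul]
    have hJpos : ∀ v ∈ J, 0 < w v := fun v hv =>
      lt_of_le_of_ne (hw0 v (Finset.mem_filter.1 hv).1) (Finset.mem_filter.1 hv).2.symm
    have hJs : ∀ v ∈ J, v ∈ s ∧ v ∈ t := fun v hv =>
      Finset.mem_inter.1 (Finset.mem_filter.1 hv).1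
    have hJc : ∀ v ∈ J, v ∈ Set.Icc (0 : Fin D → ℝ) 1 := fun v hv =>
      hF₀.convexHull_subset_cube hs (subset_convexHull ℝ _ (hJs v hv).1)
    have hkl : ∀ v ∈ J, mirrorMap k v = mirrorMap l v := by
      intro v hv
      ext i
      rcases (hcoord i).2 with h | ⟨h, h'⟩
      · simp only [mirrorMap, h]
      · refine h' v (eq_of_sum_eq_zero_or_one (c := fun v => v i) hJpos hJ1
          (fun u hu => ⟨(hJc u hu).1 i, (hJc u hu).2 i⟩) ?_ h v hv)
        rw [← hJa]
        simp [Finset.sum_apply]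
    have haJ : a ∈ convexHull ℝ (J : Set (Fin D → ℝ)) :=
      Finset.mem_convexHull'.2 ⟨w, fun v hv => (hJpos v hv).le, hJ1, hJa⟩
    have := Set.mem_image_of_mem (mirrorMap k) haJ
    rw [mirrorMap_image_convexHull] at this
    refine convexHull_mono ?_ this
    rintro _ ⟨v, hv, rfl⟩
    refine ⟨Finset.mem_coe.2 (Finset.mem_image_of_mem _ (hJs v hv).1), ?_⟩
    rw [hkl v hv]
    exact Finset.mem_coe.2 (Finset.mem_image_of_mem _ (hJs v hv).2)
  · rintro _ ⟨k, s, hs, rfl⟩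
    obtain ⟨K, -, hface, -⟩ := id hF₀
    obtain ⟨t, ht, hst, hcard⟩ := hface s hs
    exact ⟨_, ⟨k, t, ht, rfl⟩, Finset.image_subset_image hst,
      by rw [Finset.card_image_of_injective _ (mirrorMap_injective k), hcard]⟩
  · rw [Set.eq_univ_iff_forall]
    intro z
    rw [Geometry.SimplicialComplex.mem_space_iff]
    obtain ⟨s, hs, hz⟩ := hF₀.exists_mem_mirror_floor z
    exact ⟨_, ⟨_, s, hs, rfl⟩, by rwa [Finset.coe_image]⟩

theorem isLocallyFiniteCover_mirror (hF₀ : IsSimplicialTiling F₀ (Set.Icc 0 1))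
    (hfin : F₀.Finite) :
    IsLocallyFiniteCover (mirrorFaces F₀) := by
  classical
  intro z
  rw [mirrorFaces_eq]
  -- Moving by less than `1` in sup norm changes each floor by at most one.
  let N : Set (Fin D → ℤ) := Set.Icc (fun i => ⌊z i⌋ - 1) (fun i => ⌊z i⌋ + 1)
  have hN : N.Finite := Set.finite_Icc _ _
  refine ⟨(fun q : (Fin D → ℤ) × Finset (Fin D → ℝ) => q.2.image (mirrorMap q.1)) '' (N ×ˢ F₀),
    (hN.prod hfin).image _, ?_, ?_⟩
  · rintro _ ⟨⟨k, s⟩, ⟨-, hs⟩, rfl⟩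
    exact ⟨k, s, hs, rfl⟩
  · filter_upwards [Metric.ball_mem_nhds z zero_lt_one] with y hy
    obtain ⟨s, hs, hys⟩ := hF₀.exists_mem_mirror_floor y
    refine ⟨_, ⟨⟨_, s⟩, ⟨?_, hs⟩, rfl⟩, by rwa [Finset.coe_image]⟩
    have hi : ∀ i, |y i - z i| < 1 := fun i => by
      rw [← Real.dist_eq]
      exact (dist_le_pi_dist y z i).trans_lt hy
    constructor
    · intro i
      have := abs_lt.1 (hi i)
      show ⌊z i⌋ - 1 ≤ ⌊y i⌋
      rw [← Int.floor_sub_one]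
      exact Int.floor_le_floor (by linarith)
    · intro i
      have := abs_lt.1 (hi i)
      show ⌊y i⌋ ≤ ⌊z i⌋ + 1
      rw [← Int.floor_add_one]
      exact Int.floor_le_floor (by linarith)

/-- Affine independence is injectivity of `u ↦ (∑ u v, ∑ u v • v)`, and an injective linear map in
finite dimension is antilipschitz. The factor `s.card` passes from sup norm to `ℓ¹`. -/
theorem exists_nondegeneracy_bound {s : Finset (Fin D → ℝ)}
    (hs : AffineIndependent ℝ ((↑) : s → Fin D → ℝ)) :
    ∃ C : ℝ, ∀ u : (Fin D → ℝ) → ℝ, ∑ v ∈ s, u v = 0 →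
      ∑ v ∈ s, |u v| ≤ C * ‖∑ v ∈ s, u v • v‖ := by
  let T : (s → ℝ) →ₗ[ℝ] ℝ × (Fin D → ℝ) :=
    (∑ v : s, LinearMap.proj v).prod
      (∑ v : s, (LinearMap.proj v : (s → ℝ) →ₗ[ℝ] ℝ).smulRight (v : Fin D → ℝ))
  have hT : ∀ u, T u = (∑ v, u v, ∑ v, u v • (v : Fin D → ℝ)) := fun u => by
    simp [T]
  have hker : LinearMap.ker T = ⊥ := by
    rw [LinearMap.ker_eq_bot']
    intro u hu
    rw [hT, Prod.mk_eq_zero] at hu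
    ext v
    exact hs.eq_zero_of_sum_eq_zero hu.1 hu.2 v (Finset.mem_univ v)
  obtain ⟨K, -, hK⟩ := T.exists_antilipschitzWith hker
  refine ⟨s.card * K, fun u hu => ?_⟩
  have h1 := hK.le_mul_dist (fun v : s => u v) 0
  rw [map_zero, dist_zero_right, dist_zero_right, hT] at h1
  rw [Finset.univ_eq_attach, Finset.sum_attach s u, hu,
    Finset.sum_attach s (fun v => u v • v), Prod.norm_mk, norm_zero,
    max_eq_right (norm_nonneg _)] at h1
  calc ∑ v ∈ s, |u v| ≤ ∑ _v ∈ s, K * ‖∑ v ∈ s, u v • v‖ := by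
        refine Finset.sum_le_sum fun v hv => le_trans ?_ h1
        exact norm_le_pi_norm (fun v : s => u v) ⟨v, hv⟩
    _ = s.card * K * ‖∑ v ∈ s, u v • v‖ := by
        rw [Finset.sum_const, nsmul_eq_mul, mul_assoc]

/-- Against weights of sum zero the translation part of `mirrorMap k` cancels, and the sign changes
are isometric, so the finitely many constants of `F₀` suffice. -/
theorem exists_isUniformlyNondegenerate_mirror (hF₀ : IsSimplicialTiling F₀ (Set.Icc 0 1))
    (hfin : F₀.Finite) :
    ∃ L, 0 ≤ L ∧ IsUniformlyNondegenerate (mirrorFaces F₀) L := by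
  classical
  have h : ∀ s : Finset (Fin D → ℝ), ∃ C : ℝ, s ∈ F₀ → ∀ u : (Fin D → ℝ) → ℝ,
      ∑ v ∈ s, u v = 0 → ∑ v ∈ s, |u v| ≤ C * ‖∑ v ∈ s, u v • v‖ := by
    intro s
    by_cases hs : s ∈ F₀
    · obtain ⟨C, hC⟩ := exists_nondegeneracy_bound (hF₀.indep hs)
      exact ⟨C, fun _ => hC⟩
    · exact ⟨0, fun h => absurd h hs⟩
  choose C hC using h
  obtain ⟨B, hB⟩ := (hfin.image C).bddAbove
  refine ⟨max B 0, le_max_right _ _, ?_⟩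
  rw [mirrorFaces_eq]
  rintro _ ⟨k, s, hs, rfl⟩ u hu
  have hinj := (mirrorMap_injective k).injOn (s := (s : Set (Fin D → ℝ)))
  rw [Finset.sum_image hinj] at hu
  rw [Finset.sum_image hinj, Finset.sum_image hinj]
  have h1 : ∑ v ∈ s, u (mirrorMap k v) • mirrorMap k v =
      mirrorSign k * ∑ v ∈ s, u (mirrorMap k v) • v := by
    calc ∑ v ∈ s, u (mirrorMap k v) • mirrorMap k v
        = ∑ v ∈ s, (mirrorSign k * (u (mirrorMap k v) • v) +
            u (mirrorMap k v) • mirrorMap k 0) := by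
          refine Finset.sum_congr rfl fun v _ => ?_
          conv_lhs => rw [mirrorMap_eq k v, smul_add, ← mirrorMap_eq k v, ← mul_smul_comm]
      _ = _ := by
          rw [Finset.sum_add_distrib, ← Finset.sum_smul, hu, zero_smul, add_zero, Finset.mul_sum]
  rw [h1, norm_mirrorSign_mul]
  refine (hC s hs (u ∘ mirrorMap k) hu).trans ?_
  exact mul_le_mul_of_nonneg_right ((hB (Set.mem_image_of_mem C hs)).trans (le_max_left _ _))
    (norm_nonneg _)

theorem exists_enumeratesVertices_mirror (hF₀ : IsSimplicialTiling F₀ (Set.Icc 0 1))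
    (hfin : F₀.Finite) (hD : 0 < D) :
    ∃ x : ℕ → Fin D → ℝ, EnumeratesVertices x (mirrorFaces F₀) := by
  classical
  set V : Set (Fin D → ℝ) := {v | {v} ∈ mirrorFaces F₀} with hV
  have hcount : V.Countable := by
    have : V ⊆ ⋃ k : Fin D → ℤ, ⋃ s ∈ F₀, mirrorMap k '' (s : Set (Fin D → ℝ)) := by
      rintro v ⟨k, s, hs, hv⟩
      refine Set.mem_iUnion.2 ⟨k, Set.mem_biUnion hs ?_⟩
      rw [← hv]
      simp
    refine Set.Countable.mono this (Set.countable_iUnion fun k => ?_)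
    exact (hfin.biUnion fun s _ => s.finite_toSet.image _).countable
  have hinf : V.Infinite := by
    obtain ⟨s, hs, -⟩ := hF₀.mem_iff.1 (show (0 : Fin D → ℝ) ∈ Set.Icc 0 1 by simp)
    obtain ⟨v, hv⟩ := hF₀.nonempty hs
    have hvF := hF₀.down_closed hs (Finset.singleton_subset_iff.2 hv) (Finset.singleton_nonempty v)
    -- Even indices involve no reflection, so these are distinct translates of one vertex.
    refine Set.infinite_of_injective_forall_mem (f := fun n : ℕ =>
      mirrorMap (fun _ : Fin D => 2 * (n : ℤ)) v) ?_ ?_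
    · intro m n hmn
      have := congrFun hmn ⟨0, hD⟩
      simp only [mirrorMap, even_two, Even.mul_right, if_true] at this
      push_cast at this
      have : (m : ℝ) = n := by linarith
      exact_mod_cast this
    · intro n
      exact ⟨fun _ => 2 * (n : ℤ), {v}, hvF, by simp⟩
  have : Infinite V := hinf.to_subtype
  have : Countable V := hcount.to_subtype
  obtain ⟨e⟩ := nonempty_equiv_of_countable (α := ℕ) (β := V)
  refine ⟨fun n => e n, Subtype.val_injective.comp e.injective, ?_⟩
  rw [show (fun n => ((e n : V) : Fin D → ℝ)) = Subtype.val ∘ e from rfl, Set.range_comp,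
    e.surjective.range_eq, Set.image_univ, Subtype.range_coe]

end IsSimplicialTiling

end Mirror

/-! ### The maximum of one coordinate as a function of the noise. -/

section SupportFunction

variable {E : Type*} [TopologicalSpace E] {D : ℕ} {β : ℕ → E → ℝ} {a : ℕ → ℝ} {c : Fin D}

/-- The `c`-th coordinate of `∑ i, β i y • (v i + e i)`, where `a i` is that of `v i`. -/
noncomputable def coordForm (β : ℕ → E → ℝ) (a : ℕ → ℝ) (c : Fin D) (y : E)
    (e : ℕ → Fin D → ℝ) : ℝ :=
  ∑ᶠ i, β i y * (a i + e i c)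

/-- The supremum of `coordForm` over the points of a sequence. -/
noncomputable def supForm (β : ℕ → E → ℝ) (a : ℕ → ℝ) (c : Fin D) (g : ℕ → E)
    (e : ℕ → Fin D → ℝ) : ℝ :=
  ⨆ n, coordForm β a c (g n) e

/-- The unit vector of the `c`-th coordinate at the index `i`. -/
def unitShift (i : ℕ) (c : Fin D) : ℕ → Fin D → ℝ := Pi.single i (Pi.single c 1)

/-- Rescaled symmetric second difference of `supForm` in the direction `unitShift i c`. -/
noncomputable def supFormDiff (β : ℕ → E → ℝ) (a : ℕ → ℝ) (c : Fin D) (i n : ℕ) (g : ℕ → E)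
    (e : ℕ → Fin D → ℝ) : ℝ :=
  ((n : ℝ) + 1) • (supForm β a c g (e + ((n : ℝ) + 1)⁻¹ • unitShift i c) - supForm β a c g e) +
  ((n : ℝ) + 1) • (supForm β a c g (e - ((n : ℝ) + 1)⁻¹ • unitShift i c) - supForm β a c g e)

theorem continuous_coordForm (hβ : ∀ i, Continuous (β i))
    (hlf : LocallyFinite fun i => Function.support (β i)) :
    Continuous fun p : E × (ℕ → Fin D → ℝ) => coordForm β a c p.1 p.2 := by
  refine continuous_finsum (fun i => ?_) ?_
  · have := (hβ i).comp (continuous_fst (X := E) (Y := ℕ → Fin D → ℝ))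
    have h2 : Continuous fun p : E × (ℕ → Fin D → ℝ) => p.2 i c := by fun_prop
    exact this.mul (continuous_const.add h2)
  · refine (hlf.preimage_continuous (continuous_fst (X := E) (Y := ℕ → Fin D → ℝ))).subset
      fun i p hp => ?_
    exact left_ne_zero_of_mul hp

/-- In a single noise vector the form is affine, with slope `β i y` along the `c`-th axis. -/
theorem coordForm_update (hlf : LocallyFinite fun i => Function.support (β i)) (y : E)
    (e : ℕ → Fin D → ℝ) (i : ℕ) (v : Fin D → ℝ) :
    coordForm β a c y (Function.update e i v) = coordForm β a c y e + β i y * (v c - e i c) := by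
  have hfin : ∀ w : ℕ → ℝ, (Function.support fun j => β j y * w j).Finite := fun w =>
    (hlf.point_finite y).subset fun j hj => left_ne_zero_of_mul hj
  have h : coordForm β a c y (Function.update e i v) - coordForm β a c y e =
      β i y * (v c - e i c) := by
    rw [coordForm, coordForm, ← finsum_sub_distrib (hfin _) (hfin _), finsum_eq_single _ i]
    · simp only [Function.update_self]
      ring
    · intro j hj
      simp [Function.update_of_ne hj]
  rw [← h, add_sub_cancel]

theorem add_smul_unitShift (e : ℕ → Fin D → ℝ) (i : ℕ) (t : ℝ) :
    e + t • unitShift i c = Function.update e i (e i + t • Pi.single c 1) := by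
  ext j : 1
  by_cases h : j = i
  · subst h
    simp [unitShift]
  · simp [unitShift, h]

theorem coordForm_add_smul (hlf : LocallyFinite fun i => Function.support (β i)) (y : E)
    (e : ℕ → Fin D → ℝ) (i : ℕ) (t : ℝ) :
    coordForm β a c y (e + t • unitShift i c) = coordForm β a c y e + β i y * t := by
  rw [add_smul_unitShift, coordForm_update hlf]
  simp

theorem coordForm_sub_smul (hlf : LocallyFinite fun i => Function.support (β i)) (y : E)
    (e : ℕ → Fin D → ℝ) (i : ℕ) (t : ℝ) :
    coordForm β a c y (e - t • unitShift i c) = coordForm β a c y e - β i y * t := by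
  rw [sub_eq_add_neg, ← neg_smul, coordForm_add_smul hlf]
  ring

theorem bddAbove_coordForm (hβ : ∀ i, Continuous (β i))
    (hlf : LocallyFinite fun i => Function.support (β i)) {g : ℕ → E} {B : Set E}
    (hB : IsCompact B) (hg : ∀ n, g n ∈ B) (e : ℕ → Fin D → ℝ) :
    BddAbove (Set.range fun n => coordForm β a c (g n) e) := by
  have hc : Continuous fun y => coordForm β a c y e :=
    (continuous_coordForm hβ hlf).comp (Continuous.prodMk_left e)
  refine (hB.bddAbove_image hc.continuousOn).mono ?_
  rintro _ ⟨n, rfl⟩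
  exact Set.mem_image_of_mem _ (hg n)

theorem lipschitzWith_supForm_update (hβ : ∀ i, Continuous (β i))
    (hlf : LocallyFinite fun i => Function.support (β i)) (hβ1 : ∀ i y, |β i y| ≤ 1)
    {g : ℕ → E} {B : Set E} (hB : IsCompact B) (hg : ∀ n, g n ∈ B)
    (e : ℕ → Fin D → ℝ) (i : ℕ) :
    LipschitzWith 1 fun v : Fin D → ℝ => supForm β a c g (Function.update e i v) := by
  refine LipschitzWith.of_le_add fun v w => ciSup_le fun n => ?_
  have h1 := le_ciSup (bddAbove_coordForm (a := a) (c := c) hβ hlf hB hg (Function.update e i w)) n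
  have h2 : coordForm β a c (g n) (Function.update e i v) =
      coordForm β a c (g n) (Function.update e i w) + β i (g n) * (v c - w c) := by
    rw [coordForm_update hlf, coordForm_update hlf]
    ring
  have h3 : β i (g n) * (v c - w c) ≤ dist v w :=
    calc β i (g n) * (v c - w c) ≤ |β i (g n)| * |v c - w c| := by
          rw [← abs_mul]
          exact le_abs_self _
      _ ≤ 1 * |v c - w c| := mul_le_mul_of_nonneg_right (hβ1 _ _) (abs_nonneg _)
      _ = dist (v c) (w c) := by rw [one_mul, Real.dist_eq]
      _ ≤ dist v w := dist_le_pi_dist v w c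
  change _ ≤ supForm β a c g (Function.update e i w) + dist v w
  rw [h2]
  exact add_le_add h1 h3

/-- By Rademacher the supremum is differentiable at almost every `v`, and there the difference
quotients in opposite directions have opposite limits. -/
theorem ae_tendsto_supFormDiff (hβ : ∀ i, Continuous (β i))
    (hlf : LocallyFinite fun i => Function.support (β i)) (hβ1 : ∀ i y, |β i y| ≤ 1)
    {g : ℕ → E} {B : Set E} (hB : IsCompact B) (hg : ∀ n, g n ∈ B)
    (e : ℕ → Fin D → ℝ) (i : ℕ) :
    ∀ᵐ v : Fin D → ℝ, Tendsto (fun n => supFormDiff β a c i n g (Function.update e i v))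
      atTop (𝓝 0) := by
  filter_upwards [(lipschitzWith_supForm_update (a := a) (c := c) hβ hlf hβ1 hB hg e
    i).ae_differentiableAt] with v hv
  have hlim : Tendsto (fun n : ℕ => ‖((n : ℝ) + 1)‖) atTop atTop :=
    tendsto_norm_atTop_atTop.comp (tendsto_atTop_add_const_right _ _ tendsto_natCast_atTop_atTop)
  have h1 := hv.hasFDerivAt.lim (Pi.single c 1) hlim
  have h2 := hv.hasFDerivAt.lim (-Pi.single c 1) hlim
  have h3 := h1.add h2
  rw [map_neg, add_neg_cancel] at h3
  refine h3.congr fun n => ?_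
  have hup : ∀ t : ℝ,
      Function.update e i v + t • unitShift i c = Function.update e i (v + t • Pi.single c 1) := by
    intro t
    rw [add_smul_unitShift, Function.update_idem, Function.update_self]
  rw [supFormDiff, hup, sub_eq_add_neg (Function.update e i v), ← neg_smul, hup, smul_neg,
    ← neg_smul]

theorem coordForm_le_supForm {X : Type*} [TopologicalSpace X] [CompactSpace X]
    (hβ : ∀ i, Continuous (β i)) (hlf : LocallyFinite fun i => Function.support (β i))
    {q : ℕ → X} (hq : DenseRange q) {Y : X → E} (hY : Continuous Y) (z : X)
    (e : ℕ → Fin D → ℝ) :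
    coordForm β a c (Y z) e ≤ supForm β a c (fun n => Y (q n)) e := by
  have hc : Continuous fun z => coordForm β a c (Y z) e :=
    (continuous_coordForm hβ hlf).comp (hY.prodMk continuous_const)
  refine hq.induction_on (p := fun z => coordForm β a c (Y z) e ≤ _) z
    (isClosed_le hc continuous_const) fun n => ?_
  exact le_ciSup (bddAbove_coordForm (g := fun n => Y (q n)) hβ hlf (isCompact_range hY)
    (fun n => Set.mem_range_self _) e) n

/-- Raising `ε i` by `1/(n+1)` along axis `c` lifts the supremum by at least `β i (Y z)/(n+1)`, and
lowering it drops the supremum by at most `β i (Y z')/(n+1)`. After rescaling, `β i (Y z) - β i (Y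
z')` is at most `supFormDiff`, which tends to `0`. -/
theorem le_of_tendsto_supFormDiff {X : Type*} [TopologicalSpace X] [CompactSpace X]
    (hβ : ∀ i, Continuous (β i)) (hlf : LocallyFinite fun i => Function.support (β i))
    {q : ℕ → X} (hq : DenseRange q) {Y : X → E} (hY : Continuous Y) {e : ℕ → Fin D → ℝ} {i : ℕ}
    (h : Tendsto (fun n => supFormDiff β a c i n (fun n => Y (q n)) e) atTop (𝓝 0))
    {z z' : X} (hz : ∀ y, coordForm β a c (Y y) e ≤ coordForm β a c (Y z) e)
    (hz' : ∀ y, coordForm β a c (Y y) e ≤ coordForm β a c (Y z') e) :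
    β i (Y z) ≤ β i (Y z') := by
  have hsup : ∀ {z}, (∀ y, coordForm β a c (Y y) e ≤ coordForm β a c (Y z) e) →
      supForm β a c (fun n => Y (q n)) e = coordForm β a c (Y z) e := fun hz =>
    le_antisymm (ciSup_le fun n => hz _) (coordForm_le_supForm hβ hlf hq hY _ _)
  rw [← sub_nonpos]
  refine ge_of_tendsto' h fun n => ?_
  have hn : (0 : ℝ) < (n : ℝ) + 1 := by positivity
  have h1 := coordForm_le_supForm (a := a) (c := c) hβ hlf hq hY z
    (e + ((n : ℝ) + 1)⁻¹ • unitShift i c)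
  have h2 := coordForm_le_supForm (a := a) (c := c) hβ hlf hq hY z'
    (e - ((n : ℝ) + 1)⁻¹ • unitShift i c)
  rw [coordForm_add_smul hlf] at h1
  rw [coordForm_sub_smul hlf] at h2
  have h3 : β i (Y z) * ((n : ℝ) + 1)⁻¹ ≤
      supForm β a c (fun n => Y (q n)) (e + ((n : ℝ) + 1)⁻¹ • unitShift i c) -
        supForm β a c (fun n => Y (q n)) e := by
    rw [hsup hz]
    linarith
  have h4 : -β i (Y z') * ((n : ℝ) + 1)⁻¹ ≤
      supForm β a c (fun n => Y (q n)) (e - ((n : ℝ) + 1)⁻¹ • unitShift i c) -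
        supForm β a c (fun n => Y (q n)) e := by
    rw [hsup hz']
    linarith
  have h5 := add_le_add (mul_le_mul_of_nonneg_left h3 hn.le) (mul_le_mul_of_nonneg_left h4 hn.le)
  refine le_trans (le_of_eq ?_) h5
  field_simp
  ring

theorem measurable_supFormDiff [MeasurableSpace E] [BorelSpace E] [SecondCountableTopology E]
    (hβ : ∀ i, Continuous (β i)) (hlf : LocallyFinite fun i => Function.support (β i)) (i n : ℕ) :
    Measurable fun p : (ℕ → E) × (ℕ → Fin D → ℝ) => supFormDiff β a c i n p.1 p.2 := by
  have hsup : Measurable fun p : (ℕ → E) × (ℕ → Fin D → ℝ) => supForm β a c p.1 p.2 := by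
    refine Measurable.iSup fun m => ?_
    have h1 : Measurable fun p : (ℕ → E) × (ℕ → Fin D → ℝ) => (p.1 m, p.2) := by fun_prop
    exact (continuous_coordForm hβ hlf).measurable.comp h1
  have hshift : ∀ v : ℕ → Fin D → ℝ,
      Measurable fun p : (ℕ → E) × (ℕ → Fin D → ℝ) => supForm β a c p.1 (p.2 + v) := by
    intro v
    have h1 : Continuous fun e : ℕ → Fin D → ℝ => e + v := by fun_prop
    exact hsup.comp (measurable_fst.prodMk (h1.measurable.comp measurable_snd))
  unfold supFormDiff
  simp_rw [sub_eq_add_neg _ (_ • unitShift i c), smul_eq_mul]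
  exact (((hshift _).sub hsup).const_mul _).add (((hshift _).sub hsup).const_mul _)

end SupportFunction

/-! ### Almost sure uniqueness of the maximizer, by independence and Fubini. -/

section Probability

variable {Ω : Type*} [MeasurableSpace Ω] {P : Measure Ω} {D : ℕ}
  {β : ℕ → (Fin D → ℝ) → ℝ} {a : ℕ → ℝ} {c : Fin D} {ε : ℕ → Ω → Fin D → ℝ}

/-- Overwriting entry `i` by `0` leaves a function of the other entries on the same sequence space,
so that `Function.update` later restores the full noise. -/
theorem indepFun_update_zero (hm : ∀ n, Measurable (ε n)) (hi : iIndepFun ε P) (i : ℕ) :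
    IndepFun (fun ω => Function.update (fun n => ε n ω) i 0) (ε i) P := by
  have h := indep_iSup_of_disjoint (fun n => (hm n).comap_le) hi
    (S := {i}ᶜ) (T := {i}) (disjoint_compl_left)
  rw [IndepFun_iff_Indep]
  refine indep_of_indep_of_le_right (indep_of_indep_of_le_left h ?_) ?_
  · rw [← measurable_iff_comap_le]
    refine @measurable_pi_lambda _ _ _ (_) _ _ fun n => ?_
    by_cases hn : n = i
    · subst hn
      simp only [Function.update_self]
      exact @measurable_const _ _ _ (_) _
    · simp only [Function.update_of_ne hn]
      rw [measurable_iff_comap_le]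
      exact le_iSup₂_of_le n hn le_rfl
  · exact le_iSup₂_of_le i rfl le_rfl

/-- With the other entries frozen, the Lebesgue-null exceptional set is null for the absolutely
continuous law of `ε i`. -/
theorem ae_tendsto_supFormDiff_of_indep [IsProbabilityMeasure P]
    (hβ : ∀ i, Continuous (β i))
    (hlf : LocallyFinite fun i => Function.support (β i)) (hβ1 : ∀ i y, |β i y| ≤ 1)
    (hm : ∀ n, Measurable (ε n)) (hi : iIndepFun ε P) (hac : ∀ n, P.map (ε n) ≪ volume)
    {g : ℕ → Fin D → ℝ} {R : ℝ} (hg : ∀ n, ‖g n‖ ≤ R) (i : ℕ) :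
    ∀ᵐ ω ∂P, Tendsto (fun n => supFormDiff β a c i n g fun m => ε m ω) atTop (𝓝 0) := by
  have hpi : Measurable fun ω => Function.update (fun n => ε n ω) i 0 :=
    measurable_pi_lambda _ fun n => by
      by_cases hn : n = i
      · subst hn
        simp
      · simpa [Function.update_of_ne hn] using hm n
  have hmap := (indepFun_iff_map_prod_eq_prod_map_map hpi.aemeasurable (hm i).aemeasurable).1
    (indepFun_update_zero hm hi i)
  have hupd : Measurable fun p : (ℕ → Fin D → ℝ) × (Fin D → ℝ) =>
      Function.update p.1 i p.2 :=
    measurable_pi_lambda _ fun n => by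
      by_cases hn : n = i
      · subst hn
        simpa using measurable_snd
      · simp only [Function.update_of_ne hn]
        fun_prop
  have hS : MeasurableSet {p : (ℕ → Fin D → ℝ) × (Fin D → ℝ) |
      Tendsto (fun n => supFormDiff β a c i n g (Function.update p.1 i p.2)) atTop (𝓝 0)} :=
    measurableSet_tendsto _ fun n =>
      (measurable_supFormDiff hβ hlf i n).comp (measurable_const.prodMk hupd)
  have hae : ∀ᵐ p ∂P.map (fun ω => (Function.update (fun n => ε n ω) i 0, ε i ω)),
      Tendsto (fun n => supFormDiff β a c i n g (Function.update p.1 i p.2)) atTop (𝓝 0) := by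
    have : IsProbabilityMeasure (P.map (ε i)) :=
      Measure.isProbabilityMeasure_map (hm i).aemeasurable
    rw [hmap, Measure.ae_prod_iff_ae_ae hS]
    exact Eventually.of_forall fun e => (hac i).ae_le (ae_tendsto_supFormDiff hβ hlf hβ1
      (isCompact_closedBall 0 R) (fun n => mem_closedBall_zero_iff.2 (hg n)) e i)
  filter_upwards [ae_of_ae_map (hpi.prodMk (hm i)).aemeasurable hae] with ω hω
  simpa using hω

theorem ae_forall_tendsto_supFormDiff [IsProbabilityMeasure P]
    (hβ : ∀ i, Continuous (β i))
    (hlf : LocallyFinite fun i => Function.support (β i)) (hβ1 : ∀ i y, |β i y| ≤ 1)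
    (hm : ∀ n, Measurable (ε n)) (hi : iIndepFun ε P) (hac : ∀ n, P.map (ε n) ≪ volume)
    {g : Ω → ℕ → Fin D → ℝ} (hgm : Measurable g)
    (hg : ∀ ω, ∃ R : ℝ, ∀ n, ‖g ω n‖ ≤ R) (hind : IndepFun g (fun ω n => ε n ω) P) :
    ∀ᵐ ω ∂P, ∀ i, Tendsto (fun n => supFormDiff β a c i n (g ω) fun m => ε m ω) atTop (𝓝 0) := by
  rw [ae_all_iff]
  intro i
  have hεm : Measurable fun ω n => ε n ω := measurable_pi_lambda _ hm
  have hmap := (indepFun_iff_map_prod_eq_prod_map_map hgm.aemeasurable hεm.aemeasurable).1 hind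
  have hS : MeasurableSet {p : (ℕ → Fin D → ℝ) × (ℕ → Fin D → ℝ) |
      Tendsto (fun n => supFormDiff β a c i n p.1 p.2) atTop (𝓝 0)} :=
    measurableSet_tendsto _ fun n => measurable_supFormDiff hβ hlf i n
  -- Natural-number bounds write this event as a countable union, hence as a measurable set that can
  -- be read under the law of `g`.
  have hbdd : ∀ᵐ y ∂P.map g, ∃ R : ℕ, ∀ n, ‖y n‖ ≤ R := by
    rw [ae_map_iff hgm.aemeasurable]
    · refine Eventually.of_forall fun ω => ?_
      obtain ⟨R, hR⟩ := hg ω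
      obtain ⟨N, hN⟩ := exists_nat_ge R
      exact ⟨N, fun n => (hR n).trans hN⟩
    · have : {y : ℕ → Fin D → ℝ | ∃ R : ℕ, ∀ n, ‖y n‖ ≤ R} =
          ⋃ R : ℕ, ⋂ n, {y : ℕ → Fin D → ℝ | ‖y n‖ ≤ R} := by
        ext
        simp
      rw [this]
      refine MeasurableSet.iUnion fun R => MeasurableSet.iInter fun n => ?_
      exact measurableSet_le (by fun_prop) measurable_const
  have hae : ∀ᵐ p ∂P.map (fun ω => (g ω, fun n => ε n ω)),
      Tendsto (fun n => supFormDiff β a c i n p.1 p.2) atTop (𝓝 0) := by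
    have : IsProbabilityMeasure (P.map fun ω n => ε n ω) :=
      Measure.isProbabilityMeasure_map hεm.aemeasurable
    rw [hmap, Measure.ae_prod_iff_ae_ae hS]
    filter_upwards [hbdd] with y ⟨R, hR⟩
    rw [ae_map_iff hεm.aemeasurable]
    · exact ae_tendsto_supFormDiff_of_indep hβ hlf hβ1 hm hi hac hR i
    · exact measurable_prodMk_left hS
  exact ae_of_ae_map (hgm.prodMk hεm).aemeasurable hae

/-- Almost surely, all points of a compact space at which `coordForm β a c (Y ω z) (ε ω)` is
maximal have the same coordinates `β i (Y ω z)`. -/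
theorem ae_unique_argmax [IsProbabilityMeasure P] {X : Type*} [TopologicalSpace X] [CompactSpace X]
    (hβ : ∀ i, Continuous (β i))
    (hlf : LocallyFinite fun i => Function.support (β i)) (hβ1 : ∀ i y, |β i y| ≤ 1)
    (hm : ∀ n, Measurable (ε n)) (hi : iIndepFun ε P) (hac : ∀ n, P.map (ε n) ≪ volume)
    {q : ℕ → X} (hq : DenseRange q) {Y : Ω → X → Fin D → ℝ} (hY : ∀ ω, Continuous (Y ω))
    (hYm : ∀ z, Measurable fun ω => Y ω z)
    (hind : IndepFun (fun ω n => Y ω (q n)) (fun ω n => ε n ω) P) :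
    ∀ᵐ ω ∂P, ∀ z z' : X,
      (∀ y, coordForm β a c (Y ω y) (fun n => ε n ω) ≤
        coordForm β a c (Y ω z) fun n => ε n ω) →
      (∀ y, coordForm β a c (Y ω y) (fun n => ε n ω) ≤
        coordForm β a c (Y ω z') fun n => ε n ω) →
      ∀ i, β i (Y ω z) = β i (Y ω z') := by
  have hbdd : ∀ ω, ∃ R : ℝ, ∀ n, ‖Y ω (q n)‖ ≤ R := by
    intro ω
    obtain ⟨R, hR⟩ := (isCompact_range (hY ω)).isBounded.exists_norm_le
    exact ⟨R, fun n => hR _ (Set.mem_range_self _)⟩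
  filter_upwards [ae_forall_tendsto_supFormDiff (a := a) (c := c) hβ hlf hβ1 hm hi hac
    (measurable_pi_lambda _ fun n => hYm (q n)) hbdd hind] with ω hω z z' hz hz' i
  exact le_antisymm (le_of_tendsto_supFormDiff hβ hlf hq (hY ω) (hω i) hz hz')
    (le_of_tendsto_supFormDiff hβ hlf hq (hY ω) (hω i) hz' hz)

end Probability

/-! ### Application to the perturbed images and conclusion. -/

namespace IsSimplicialTiling

variable {D : ℕ} {x : ℕ → Fin D → ℝ} {F : Set (Finset (Fin D → ℝ))}

theorem perturbationMap_apply (hF : IsSimplicialTiling F Set.univ) (hx : EnumeratesVertices x F)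
    (ε : ℕ → Fin D → ℝ) (z : Fin D → ℝ) (c : Fin D) :
    perturbationMap x F ε z c =
      coordForm (fun i z => bary x F z i) (fun i => x i c) c z ε := by
  rw [hF.perturbationMap_eq hx, coordForm,
    finsum_eq_sum_of_support_subset (s := (bary x F z).support)]
  · simp [Finset.sum_apply, mul_add]
  · intro i hi
    exact Finsupp.mem_support_iff.2 (left_ne_zero_of_mul hi)

theorem continuous_perturbationMap (hF : IsSimplicialTiling F Set.univ)
    (hx : EnumeratesVertices x F) {L : ℝ} (hL : 0 ≤ L) (hLF : IsLocallyFiniteCover F)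
    (hU : IsUniformlyNondegenerate F L) (ε : ℕ → Fin D → ℝ) :
    Continuous (perturbationMap x F ε) := by
  refine continuous_pi fun c => ?_
  simp_rw [hF.perturbationMap_apply hx]
  exact (continuous_coordForm (hF.continuous_bary hx hL hLF hU)
    (hF.locallyFinite_support_bary hx hLF)).comp (Continuous.prodMk_left ε)

theorem ae_exists_unique_coord (hF : IsSimplicialTiling F Set.univ)
    (hx : EnumeratesVertices x F) {L : ℝ} (hL : 0 ≤ L) (hLF : IsLocallyFiniteCover F)
    (hU : IsUniformlyNondegenerate F L) {δ : ℝ} (hδ : 0 < δ) {Ω : Type*} [MeasurableSpace Ω]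
    {P : Measure Ω} [IsProbabilityMeasure P] {ε : ℕ → Ω → Fin D → ℝ}
    {G : Ω → (Fin D → ℝ) → Fin D → ℝ} (hm : ∀ n, Measurable (ε n)) (hi : iIndepFun ε P)
    (hac : ∀ n, P.map (ε n) ≪ volume) (hG : ∀ ω, Continuous (G ω))
    (hGm : ∀ z, Measurable fun ω => G ω z) (hind : IndepFun G (fun ω n => ε n ω) P)
    {M : Set (Fin D → ℝ)} (hM : IsCompact M) (hMne : M.Nonempty) (c : Fin D) :
    ∀ᵐ ω ∂P, ∃ p ∈ (fun z => δ • perturbationMap x F (fun n => ε n ω) (δ⁻¹ • G ω z)) '' M,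
      ∀ p' ∈ (fun z => δ • perturbationMap x F (fun n => ε n ω) (δ⁻¹ • G ω z)) '' M,
        p' c = p c → p' = p := by
  have : CompactSpace M := isCompact_iff_compactSpace.1 hM
  have : Nonempty M := hMne.to_subtype
  have hYc : ∀ ω, Continuous fun z : M => δ⁻¹ • G ω z := fun ω =>
    (continuous_const_smul δ⁻¹).comp ((hG ω).comp continuous_subtype_val)
  have hind' : IndepFun (fun ω n => δ⁻¹ • G ω (TopologicalSpace.denseSeq M n))
      (fun ω n => ε n ω) P := by
    refine hind.comp (φ := fun (f : (Fin D → ℝ) → Fin D → ℝ) (n : ℕ) =>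
      δ⁻¹ • f (TopologicalSpace.denseSeq M n)) (ψ := id) ?_ measurable_id
    exact measurable_pi_lambda _ fun n => (measurable_const_smul δ⁻¹).comp (measurable_pi_apply _)
  have hβ := hF.continuous_bary hx hL hLF hU
  have hlf := hF.locallyFinite_support_bary hx hLF
  filter_upwards [ae_unique_argmax (a := fun i => x i c) (c := c) hβ hlf
    (fun i y => abs_le.2 ⟨by linarith [hF.bary_nonneg hx y i], hF.bary_le_one hx y i⟩) hm hi hac
    (TopologicalSpace.denseRange_denseSeq M) hYc
    (fun z => (measurable_const_smul δ⁻¹).comp (hGm z)) hind'] with ω hω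
  simp_rw [← hF.perturbationMap_apply hx] at hω
  have hcont : Continuous fun z : M =>
      perturbationMap x F (fun n => ε n ω) (δ⁻¹ • G ω z) c :=
    (continuous_apply c).comp
      ((hF.continuous_perturbationMap hx hL hLF hU fun n => ε n ω).comp (hYc ω))
  -- The distinguished point maximizes coordinate `c`; any image point with the same `c`-th
  -- coordinate is again a maximizer.
  obtain ⟨z, -, hz⟩ := isCompact_univ.exists_isMaxOn Set.univ_nonempty hcont.continuousOn
  refine ⟨_, Set.mem_image_of_mem _ z.2, ?_⟩
  rintro _ ⟨z', hz', rfl⟩ heq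
  have heq' : perturbationMap x F (fun n => ε n ω) (δ⁻¹ • G ω z') c =
      perturbationMap x F (fun n => ε n ω) (δ⁻¹ • G ω z) c :=
    mul_left_cancel₀ hδ.ne' heq
  have h := hω z ⟨z', hz'⟩ (fun y => hz (Set.mem_univ y)) fun y => by
    rw [heq']
    exact hz (Set.mem_univ y)
  have h2 : δ⁻¹ • G ω z = δ⁻¹ • G ω z' := hF.bary_injective hx (Finsupp.ext h)
  simp only [h2]

end IsSimplicialTiling

/-- Fixing a whole block of coordinates at those of `p` is at least as restrictive as fixing one of
them, and that one already isolates `p`. -/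
theorem ncard_fiber_eq_one {α ι : Type*} {S : Set (α → ℝ)} {p : α → ℝ} (hp : p ∈ S) (f : ι → α)
    (i : ι) (h : ∀ p' ∈ S, p' (f i) = p (f i) → p' = p) :
    ({z | ∀ j, z (f j) = p (f j)} ∩ S).ncard = 1 := by
  rw [Set.ncard_eq_one]
  refine ⟨p, Set.Subset.antisymm (fun z hz => h z hz.2 (hz.1 i)) ?_⟩
  rintro _ rfl
  exact ⟨fun _ => rfl, hp⟩

theorem mainTheorem7 (d₁ d₂ : ℕ) (hd₁ : 0 < d₁) (hd₂ : 0 < d₂)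
    (F₀ : Set (Finset (Fin (d₁ + d₂) → ℝ))) (hF₀_fin : F₀.Finite)
    (hF₀ : IsSimplicialTiling F₀ (Set.Icc 0 1)) :
    IsSimplicialTiling (mirrorFaces F₀) Set.univ ∧
    (∃ x : ℕ → Fin (d₁ + d₂) → ℝ, EnumeratesVertices x (mirrorFaces F₀)) ∧
    ∀ x : ℕ → Fin (d₁ + d₂) → ℝ, EnumeratesVertices x (mirrorFaces F₀) →
      (∃ r₀ : ℝ, IsAdmissibleRadius x (mirrorFaces F₀) r₀) ∧
      ∀ r₀ : ℝ, IsAdmissibleRadius x (mirrorFaces F₀) r₀ →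
      ∀ r : ℝ, 0 < r → r ≤ r₀ → ∀ δ : ℝ, 0 < δ →
      ∀ {Ω : Type*} [MeasurableSpace Ω] (P : Measure Ω) [IsProbabilityMeasure P]
        (ε : ℕ → Ω → Fin (d₁ + d₂) → ℝ) (G : Ω → (Fin (d₁ + d₂) → ℝ) → Fin (d₁ + d₂) → ℝ),
        (∀ n, Measurable (ε n)) → iIndepFun ε P →
        (∀ n, pdf.IsUniform (ε n) (centeredCube (d₁ + d₂) r) P volume) →
        (∀ ω, Continuous (G ω)) → (∀ z, Measurable fun ω => G ω z) →
        IndepFun G (fun ω n => ε n ω) P →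
        ∀ M : Set (Fin (d₁ + d₂) → ℝ), IsCompact M → M.Nonempty →
          ∀ᵐ ω ∂P,
            (fun z => δ • perturbationMap x (mirrorFaces F₀) (fun n => ε n ω) (δ⁻¹ • G ω z)) '' M
              ∈ setB₁ d₁ d₂ ∩ setB₂ d₁ d₂ := by
  have hF := hF₀.mirror
  have hLF := hF₀.isLocallyFiniteCover_mirror hF₀_fin
  obtain ⟨L, hL, hU⟩ := hF₀.exists_isUniformlyNondegenerate_mirror hF₀_fin
  refine ⟨hF, hF₀.exists_enumeratesVertices_mirror hF₀_fin (by omega), fun x hx =>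
    ⟨exists_isAdmissibleRadius hF hx hL hLF hU, ?_⟩⟩
  intro r₀ _ r _ _ δ hδ Ω _ P _ ε G hm hi hunif hG hGm hind M hM hMne
  have hac : ∀ n, P.map (ε n) ≪ volume := fun n => (hunif n).absolutelyContinuous
  filter_upwards [
    hF.ae_exists_unique_coord hx hL hLF hU hδ hm hi hac hG hGm hind hM hMne
      (Fin.castAdd d₂ ⟨0, hd₁⟩),
    hF.ae_exists_unique_coord hx hL hLF hU hδ hm hi hac hG hGm hind hM hMne
      (Fin.natAdd d₁ ⟨0, hd₂⟩)] with ω ⟨p₁, hp₁, h₁⟩ ⟨p₂, hp₂, h₂⟩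
  have hcomp : IsCompact ((fun z => δ • perturbationMap x (mirrorFaces F₀) (fun n => ε n ω)
      (δ⁻¹ • G ω z)) '' M) :=
    hM.image ((continuous_const_smul δ).comp ((hF.continuous_perturbationMap hx hL hLF hU _).comp
      ((continuous_const_smul δ⁻¹).comp (hG ω))))
  exact ⟨⟨hcomp, _, ncard_fiber_eq_one hp₁ (Fin.castAdd d₂) _ h₁⟩,
    ⟨hcomp, _, ncard_fiber_eq_one hp₂ (Fin.natAdd d₁) _ h₂⟩⟩
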